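/- All vector spaces are complex. For a $*$-vector space $V$, $M_n(V)$ carries the involution $[v_{ij}]^*=[v_{ji}^*]$. \textbf{Local operator systems.} A local operator system $\big(V,\{\{\mathcal C_\alpha^n\}_{n}:\alpha\in\Gamma\},e\big)$ consists of a $*$-vector space $V$, convex cones $\mathcal C_\alpha^n\subseteq M_n(V)_h$ that for each $n$ are downward filtered in $\alpha$ and satisfy $\bigcap_\alpha(\mathcal C_\alpha^n\cap-\mathcal C_\alpha^n)=\{0\}$ and $X^*\mathcal C_\alpha^nX\subseteq\mathcal C_\alpha^m$ for all scalar $n\times m$ matrices $X$, and an element $e=e^*\in V$ such that, with $e_n=\mathrm{diag}(e,\dots,e)$, for all $\alpha,n$: for every $A\in M_n(V)_h$ there is $r>0$ with $re_n-A\in\mathcal C_\alpha^n$; and if $re_n+A\in\mathcal C_\alpha^n$ for all $r>0$, then $A\in\mathcal C_\alpha^n$. Its induced matrix seminorms are $$\|A\|_\alpha^n=\inf\Big\{r\ge0:\begin{pmatrix}re_n&A\\A^*&re_n\end{pmatrix}\in\mathcal C_\alpha^{2n}\Big\},\qquad A\in M_n(V).$$ A linear map $\varphi:V\to M_n$ is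 in $LUCP$ with respect to $\mathcal C_\alpha$ if $\varphi(e)=I$ and $\varphi^{(k)}(\mathcal C_\alpha^k)\subseteq M_{kn}^+$ for all $k$. \textbf{Local operator system structures on $S\otimes T$.} Let $(S,\{\mathcal C_\alpha^n\}_{\alpha\in\Gamma},e_S)$ and $(T,\{\mathcal D_\beta^n\}_{\beta\in\Lambda},e_T)$ be local operator systems. A local operator system structure $\tau$ on the algebraic tensor product $S\otimes T$ (with $(s\otimes t)^*=s^*\otimes t^*$) is a family of cones $\mathcal T_\gamma^n\subseteq M_n(S\otimes T)$, $\gamma\in\Gamma\times\Lambda$, such that: (a) $(S\otimes T,\{\mathcal T_\gamma^n\},e_S\otimes e_T)$ is a local operator system; (b) for every $(\alpha,\beta)$ there is $\gamma$, and for every $\gamma$ there is $(\alpha,\beta)$, such that $\mathcal C_\alpha^n\otimes\mathcal D_\beta^m\subseteq\mathcal T_\gamma^{nm}$ for all $n,m$; (c) if $\varphi:S\to M_n$ and $\psi:T\to M_m$ are $LUCP$ with respect to $\mathcal C_\alpha$ and $\mathcal D_\beta$, then $\varphi\otimes\psi:S\otimes T\to M_{nm}$ is $LUCP$ with respect to $\mathcal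 T_{(\alpha,\beta)}$. \textbf{Local operator spaces.} A local operator space is a vector space $E$ with a family of matrix seminorms $\{\|\cdot\|_\rho^n\}_{n}$, $\rho\in\Gamma$, that is, seminorms on $M_n(E)$ with $\|A\oplus B\|_\rho^{m+n}=\max(\|A\|_\rho^m,\|B\|_\rho^n)$ and $\|aAb\|_\rho^n\le\|a\|\,\|A\|_\rho^m\,\|b\|$ for scalar matrices $a,b$, which is separated: if $A\in M_n(E)$ and $\|A\|_\rho^n=0$ for all $\rho$, then $A=0$. A linear map $\varphi:E\to M_n$ is locally completely bounded with respect to $\rho$ if for some $K>0$ one has $\|\varphi^{(k)}(A)\|\le K\|A\|_\rho^k$ for all $k$ and $A\in M_k(E)$ (operator norm on $M_k(M_n)=M_{kn}$); $\|\varphi\|_\rho^{l.c.b}$ is the least $K\geq 0$ with this property. \textbf{Proposition.} Let $S$ and $T$ be local operator systems and let $\tau$ be a local operator system structure on $S\otimes T$. Then $S$, $T$ and $S\otimes_\tau T$, with their induced matrix seminorms, are local operator spaces, and $S\otimes_\tau T$ is a local operator space tensor product of $S$ and $T$; that is: (1) $(S\otimes T,\{\|\cdot\|_\gamma^n\})_{\gamma\in\Gamma\times\Lambda}$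 is a local operator space; (2) for every $(\alpha,\beta)\in\Gamma\times\Lambda$ there is $\gamma\in\Gamma\times\Lambda$, and for every $\gamma$ there is $(\alpha,\beta)$, such that $\|s\otimes t\|_\gamma^{nm}\le\|s\|_\alpha^n\,\|t\|_\beta^m$ for all $n,m$, $s\in M_n(S)$, $t\in M_m(T)$; (3) if linear maps $\varphi:S\to M_n$ and $\psi:T\to M_m$ are locally completely bounded with respect to $\alpha$ and $\beta$, then $\varphi\otimes\psi:S\otimes T\to M_{nm}$ is locally completely bounded with respect to $(\alpha,\beta)$, and $\|\varphi\otimes\psi\|_{(\alpha,\beta)}^{l.c.b}\le\|\varphi\|_\alpha^{l.c.b}\,\|\psi\|_\beta^{l.c.b}$. -/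

import Mathlib

open scoped TensorProduct Matrix ComplexOrder

noncomputable section

/-! ### Matrices over a complex vector space

The level-`n` matrix space of `V` is `Matrix (Fin n) (Fin n) V`, with `Aᴴ i j = star (A j i)`.
Block matrices and Kronecker products are transported to the index types `Fin (m + n)` and
`Fin (n * m)`. -/

section MatrixSpaces

variable {V : Type*} [AddCommGroup V] [Module ℂ V]

/-- The product `a A b` of scalar matrices `a`, `b` with a matrix `A` over `V`. -/
def sandwich {m n : ℕ} (a : Matrix (Fin n) (Fin m) ℂ) (A : Matrix (Fin m) (Fin m) V)
    (b : Matrix (Fin m) (Fin n) ℂ) : Matrix (Fin n) (Fin n) V :=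
  fun i j => ∑ k, ∑ l, (a i k * b l j) • A k l

/-- The `2 × 2` block matrix with blocks `A`, `B`, `C`, `D`, as a matrix of size `m + n`. -/
def blockMatrix {m n : ℕ} (A : Matrix (Fin m) (Fin m) V) (B : Matrix (Fin m) (Fin n) V)
    (C : Matrix (Fin n) (Fin m) V) (D : Matrix (Fin n) (Fin n) V) :
    Matrix (Fin (m + n)) (Fin (m + n)) V :=
  Matrix.reindex finSumFinEquiv finSumFinEquiv (Matrix.fromBlocks A B C D)

/-- The matrix `r eₙ = diag(r e, …, r e)`. -/
def scaledUnit (e : V) (n : ℕ) (r : ℝ) : Matrix (Fin n) (Fin n) V :=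
  Matrix.diagonal fun _ => (r : ℂ) • e

/-- The tensor product `A ⊗ B = [a_{ij} ⊗ b_{kl}]` of matrices over `V` and `W`, as a matrix of
size `n * m` over `V ⊗ W`. -/
def tensorMatrix {W : Type*} [AddCommGroup W] [Module ℂ W] {n m : ℕ}
    (A : Matrix (Fin n) (Fin n) V) (B : Matrix (Fin m) (Fin m) W) :
    Matrix (Fin (n * m)) (Fin (n * m)) (V ⊗[ℂ] W) :=
  Matrix.reindex finProdFinEquiv finProdFinEquiv
    (Matrix.kroneckerMap (fun v w => v ⊗ₜ[ℂ] w) A B)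

/-- The amplification `φ⁽ᵏ⁾ : M_k(V) → M_k(M_ι)` of `φ : V → M_ι`, where `M_k(M_ι)` is identified
with the scalar matrices indexed by `Fin k × ι`. -/
def amplify {ι : Type*} (φ : V →ₗ[ℂ] Matrix ι ι ℂ) {k : ℕ} (A : Matrix (Fin k) (Fin k) V) :
    Matrix (Fin k × ι) (Fin k × ι) ℂ :=
  Matrix.comp (Fin k) (Fin k) ι ι ℂ (A.map φ)

/-- The map `φ ⊗ ψ : V ⊗ W → M_ι ⊗ M_κ = M_{ι × κ}`, `v ⊗ w ↦ φ v ⊗ ψ w`. -/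
def tensorMap {W : Type*} [AddCommGroup W] [Module ℂ W] {ι κ : Type*}
    (φ : V →ₗ[ℂ] Matrix ι ι ℂ) (ψ : W →ₗ[ℂ] Matrix κ κ ℂ) :
    V ⊗[ℂ] W →ₗ[ℂ] Matrix (ι × κ) (ι × κ) ℂ :=
  TensorProduct.lift ((Matrix.kroneckerMapBilinear (LinearMap.mul ℂ ℂ)).compl₁₂ φ ψ)

end MatrixSpaces

/-! ### Local operator systems -/

/-- A local operator system structure on the complex `*`-vector space `V`, indexed by `Γ`. -/
structure LocalOperatorSystem (Γ : Type*) (V : Type*) [AddCommGroup V] [Module ℂ V]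
    [StarAddMonoid V] [StarModule ℂ V] where
  /-- the cones `C_αⁿ ⊆ M_n(V)` -/
  cone : Γ → (n : ℕ) → PointedCone ℝ (Matrix (Fin n) (Fin n) V)
  /-- the Archimedean matrix order unit -/
  unit : V
  isHermitian_of_mem : ∀ α n, ∀ A ∈ cone α n, A.IsHermitian
  /-- the cones of each level are downward filtered -/
  filtered : ∀ n α β, ∃ γ, cone γ n ≤ cone α n ∧ cone γ n ≤ cone β n
  eq_zero_of_mem : ∀ n (A : Matrix (Fin n) (Fin n) V),
    (∀ α, A ∈ cone α n ∧ -A ∈ cone α n) → A = 0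
  /-- `X^* C_αⁿ X ⊆ C_αᵐ` for every scalar `n × m` matrix `X` -/
  compatible : ∀ α n m (X : Matrix (Fin n) (Fin m) ℂ), ∀ A ∈ cone α n,
    sandwich Xᴴ A X ∈ cone α m
  unit_isSelfAdjoint : IsSelfAdjoint unit
  orderUnit : ∀ α n (A : Matrix (Fin n) (Fin n) V), A.IsHermitian →
    ∃ r : ℝ, 0 < r ∧ scaledUnit unit n r - A ∈ cone α n
  archimedean : ∀ α n (A : Matrix (Fin n) (Fin n) V),
    (∀ r : ℝ, 0 < r → scaledUnit unit n r + A ∈ cone α n) → A ∈ cone α n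

namespace LocalOperatorSystem

variable {Γ V : Type*} [AddCommGroup V] [Module ℂ V] [StarAddMonoid V] [StarModule ℂ V]

/-- The induced matrix seminorms
`‖A‖_αⁿ = inf {r ≥ 0 : [[r eₙ, A], [A^*, r eₙ]] ∈ C_α²ⁿ}`. -/
def seminorm (𝒮 : LocalOperatorSystem Γ V) (α : Γ) (n : ℕ) (A : Matrix (Fin n) (Fin n) V) : ℝ :=
  sInf {r : ℝ | 0 ≤ r ∧
    blockMatrix (scaledUnit 𝒮.unit n r) A Aᴴ (scaledUnit 𝒮.unit n r) ∈ 𝒮.cone α (n + n)}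

/-- `φ : V → M_ι` is local unital completely positive with respect to the cones `C_α`. -/
structure IsLUCP (𝒮 : LocalOperatorSystem Γ V) (α : Γ) {ι : Type*} [Fintype ι] [DecidableEq ι]
    (φ : V →ₗ[ℂ] Matrix ι ι ℂ) : Prop where
  map_unit : φ 𝒮.unit = 1
  posSemidef : ∀ k, ∀ A ∈ 𝒮.cone α k, (amplify φ A).PosSemidef

/-- `τ` is a local operator system structure on the tensor product of the local operator systems
`𝒮` and `𝒯`; its cones are indexed by `Γ × Λ`. -/
structure IsTensorStructure {Λ W : Type*} [AddCommGroup W] [Module ℂ W] [StarAddMonoid W]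
    [StarModule ℂ W] (𝒮 : LocalOperatorSystem Γ V) (𝒯 : LocalOperatorSystem Λ W)
    (τ : LocalOperatorSystem (Γ × Λ) (V ⊗[ℂ] W)) : Prop where
  unit_eq : τ.unit = 𝒮.unit ⊗ₜ[ℂ] 𝒯.unit
  exists_index : ∀ α β, ∃ γ, ∀ n m, ∀ P ∈ 𝒮.cone α n, ∀ Q ∈ 𝒯.cone β m,
    tensorMatrix P Q ∈ τ.cone γ (n * m)
  exists_pair : ∀ γ, ∃ α β, ∀ n m, ∀ P ∈ 𝒮.cone α n, ∀ Q ∈ 𝒯.cone β m,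
    tensorMatrix P Q ∈ τ.cone γ (n * m)
  isLUCP_tensorMap : ∀ α β n m (φ : V →ₗ[ℂ] Matrix (Fin n) (Fin n) ℂ)
    (ψ : W →ₗ[ℂ] Matrix (Fin m) (Fin m) ℂ), 𝒮.IsLUCP α φ → 𝒯.IsLUCP β ψ →
    τ.IsLUCP (α, β) (tensorMap φ ψ)

end LocalOperatorSystem

/-! ### Local operator spaces

A family of matrix seminorms on `V` is a function `p` assigning to an index `ρ` and a level `n` a
real function on `M_n(V)`. Scalar matrices carry the operator norm on Euclidean space. -/

section LocalOperatorSpaces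

open scoped Matrix.Norms.L2Operator

variable {Γ V : Type*} [AddCommGroup V] [Module ℂ V]

/-- `p` is a separated family of matrix seminorms, i.e. it makes `V` a local operator space. -/
structure IsLocalOperatorSpace (p : Γ → (n : ℕ) → Matrix (Fin n) (Fin n) V → ℝ) : Prop where
  nonneg : ∀ ρ n A, 0 ≤ p ρ n A
  add_le : ∀ ρ n A B, p ρ n (A + B) ≤ p ρ n A + p ρ n B
  smul_eq : ∀ ρ n (c : ℂ) A, p ρ n (c • A) = ‖c‖ * p ρ n A
  directSum : ∀ ρ m n (A : Matrix (Fin m) (Fin m) V) (B : Matrix (Fin n) (Fin n) V),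
    p ρ (m + n) (blockMatrix A 0 0 B) = max (p ρ m A) (p ρ n B)
  sandwich_le : ∀ ρ m n (a : Matrix (Fin n) (Fin m) ℂ) (A : Matrix (Fin m) (Fin m) V)
    (b : Matrix (Fin m) (Fin n) ℂ), p ρ n (sandwich a A b) ≤ ‖a‖ * p ρ m A * ‖b‖
  separated : ∀ n A, (∀ ρ, p ρ n A = 0) → A = 0

/-- `K` bounds all amplifications of `φ : V → M_ι` with respect to the matrix seminorms `p ρ`. -/
def IsCompleteBound (p : Γ → (n : ℕ) → Matrix (Fin n) (Fin n) V → ℝ) (ρ : Γ) {ι : Type*}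
    [Fintype ι] [DecidableEq ι] (φ : V →ₗ[ℂ] Matrix ι ι ℂ) (K : ℝ) : Prop :=
  ∀ k (A : Matrix (Fin k) (Fin k) V), ‖amplify φ A‖ ≤ K * p ρ k A

/-- `φ : V → M_ι` is locally completely bounded with respect to `ρ`. -/
def IsLCB (p : Γ → (n : ℕ) → Matrix (Fin n) (Fin n) V → ℝ) (ρ : Γ) {ι : Type*}
    [Fintype ι] [DecidableEq ι] (φ : V →ₗ[ℂ] Matrix ι ι ℂ) : Prop :=
  ∃ K : ℝ, 0 < K ∧ IsCompleteBound p ρ φ K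

/-- The local complete bound `‖φ‖_ρ`: the least `K ≥ 0` bounding all amplifications. -/
def lcbNorm (p : Γ → (n : ℕ) → Matrix (Fin n) (Fin n) V → ℝ) (ρ : Γ) {ι : Type*}
    [Fintype ι] [DecidableEq ι] (φ : V →ₗ[ℂ] Matrix ι ι ℂ) : ℝ :=
  sInf {K : ℝ | 0 ≤ K ∧ IsCompleteBound p ρ φ K}

/-- The matrix seminorms `q` make `E ⊗ F` a local operator space tensor product of the local
operator spaces `(E, pE)` and `(F, pF)`; they are indexed by `Γ × Λ`. -/
structure IsLocalOperatorSpaceTensorProduct {Γ Λ E F : Type*} [AddCommGroup E] [Module ℂ E]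
    [AddCommGroup F] [Module ℂ F]
    (pE : Γ → (n : ℕ) → Matrix (Fin n) (Fin n) E → ℝ)
    (pF : Λ → (n : ℕ) → Matrix (Fin n) (Fin n) F → ℝ)
    (q : Γ × Λ → (n : ℕ) → Matrix (Fin n) (Fin n) (E ⊗[ℂ] F) → ℝ) : Prop where
  left : IsLocalOperatorSpace pE
  right : IsLocalOperatorSpace pF
  isLocalOperatorSpace : IsLocalOperatorSpace q
  exists_index : ∀ ρ σ, ∃ δ, ∀ n m (A : Matrix (Fin n) (Fin n) E) (B : Matrix (Fin m) (Fin m) F),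
    q δ (n * m) (tensorMatrix A B) ≤ pE ρ n A * pF σ m B
  exists_pair : ∀ δ, ∃ ρ σ, ∀ n m (A : Matrix (Fin n) (Fin n) E) (B : Matrix (Fin m) (Fin m) F),
    q δ (n * m) (tensorMatrix A B) ≤ pE ρ n A * pF σ m B
  lcb_tensorMap : ∀ ρ σ n m (φ : E →ₗ[ℂ] Matrix (Fin n) (Fin n) ℂ)
    (ψ : F →ₗ[ℂ] Matrix (Fin m) (Fin m) ℂ), IsLCB pE ρ φ → IsLCB pF σ ψ →
    IsLCB q (ρ, σ) (tensorMap φ ψ) ∧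
      lcbNorm q (ρ, σ) (tensorMap φ ψ) ≤ lcbNorm pE ρ φ * lcbNorm pF σ ψ

end LocalOperatorSpaces

end

/-! Everything is read off the `2 × 2` matrix with diagonal `r e` and corners `A`, `A^*`. By the
order unit and Archimedean axioms the infimum defining the seminorm is over a nonempty set and is
attained (`isNormBound_seminorm`). The seminorm axioms then follow by adding, compressing and
conjugating such matrices. For `A ⊗ B`, the tensor product of the two block matrices for `A` and `B`
is positive, and its compression to the two matching corners is the block matrix of `A ⊗ B` with
diagonal `r s (e ⊗ e)`.

For completely bounded maps, rescale to complete contractions. The hypothesis on `τ` concerns only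
unital completely positive maps, so a complete contraction `φ : V → M_ι` has to be reached from
those. Paulsen's off-diagonal technique does this: `φ` defines a functional on the matrices with
blocks `a ⊗ e`, `x`, `0`, `b ⊗ e`, positive by `trace_sum_nonneg`. M. Riesz extension and the
correspondence between positive functionals on `M_{ι ⊕ ι}(V)` and completely positive maps into
`M_{ι ⊕ ι}` produce a completely positive map with corner `φ` (`exists_isCP_corner`). An
`ε`-perturbation makes its value at `e` invertible, and normalising gives `φ = a θ b` with `θ`
unital and `a a^* = b^* b = 1 + ε` (`exists_isLUCP_mulMap`).

Then `φ ⊗ ψ` is the compression by `a ⊗ c` and `b ⊗ d` of a tensor product of unital completely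
positive maps. That product is completely contractive by (c), so `φ ⊗ ψ` has complete bound `(1 +
ε)²`; now let `ε → 0`. -/

open scoped Kronecker

noncomputable section

/-! ### Scalar matrices acting on matrices over a vector space -/

section RectSandwich

variable {V : Type*} [AddCommGroup V] [Module ℂ V]
variable {ι ι' κ κ' μ μ' : Type*} [Fintype ι] [Fintype ι'] [Fintype κ] [Fintype κ']

/-- The product `a A b` for rectangular scalar matrices `a`, `b` and a matrix `A` over `V`. -/
def rectSandwich (a : Matrix κ ι ℂ) (A : Matrix ι ι' V) (b : Matrix ι' κ' ℂ) : Matrix κ κ' V :=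
  fun i j => ∑ k, ∑ l, (a i k * b l j) • A k l

/-- The matrix `P ⊗ v = [p_{ij} v]`. -/
def scalarTensor (P : Matrix ι ι' ℂ) (v : V) : Matrix ι ι' V :=
  fun i j => P i j • v

omit [Fintype ι] [Fintype ι'] in
lemma scalarTensor_add (P Q : Matrix ι ι' ℂ) (v : V) :
    scalarTensor (P + Q) v = scalarTensor P v + scalarTensor Q v := by
  ext i j; simp [scalarTensor, add_smul]

omit [Fintype κ] [Fintype κ'] in
lemma rectSandwich_add (a : Matrix κ ι ℂ) (A B : Matrix ι ι' V) (b : Matrix ι' κ' ℂ) :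
    rectSandwich a (A + B) b = rectSandwich a A b + rectSandwich a B b := by
  ext i j; simp [rectSandwich, Finset.sum_add_distrib]

omit [Fintype κ] [Fintype κ'] in
lemma rectSandwich_smul (a : Matrix κ ι ℂ) (c : ℂ) (A : Matrix ι ι' V) (b : Matrix ι' κ' ℂ) :
    rectSandwich a (c • A) b = c • rectSandwich a A b := by
  ext i j; simp [rectSandwich, Finset.smul_sum, smul_comm c]

omit [Fintype κ] [Fintype κ'] in
lemma rectSandwich_neg (a : Matrix κ ι ℂ) (A : Matrix ι ι' V) (b : Matrix ι' κ' ℂ) :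
    rectSandwich a (-A) b = -rectSandwich a A b := by
  simpa using rectSandwich_smul a (-1) A b

lemma rectSandwich_rectSandwich (a : Matrix μ κ ℂ) (b : Matrix κ ι ℂ) (A : Matrix ι ι' V)
    (c : Matrix ι' κ' ℂ) (d : Matrix κ' μ' ℂ) :
    rectSandwich a (rectSandwich b A c) d = rectSandwich (a * b) A (c * d) := by
  ext i j
  simp only [rectSandwich, Matrix.mul_apply, Finset.smul_sum, Finset.sum_mul_sum, Finset.sum_smul,
    smul_smul]
  have key (f : κ → κ' → ι → ι' → V) :
      ∑ p, ∑ q, ∑ k, ∑ l, f p q k l = ∑ k, ∑ l, ∑ p, ∑ q, f p q k l := by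
    simpa only [Fintype.sum_prod_type] using
      Finset.sum_comm (s := .univ) (t := .univ)
        (f := fun (x : κ × κ') (y : ι × ι') => f x.1 x.2 y.1 y.2)
  rw [key]
  refine Finset.sum_congr rfl fun k _ => Finset.sum_congr rfl fun l _ => Finset.sum_congr rfl
    fun p _ => Finset.sum_congr rfl fun q _ => ?_
  congr 1
  ring

omit [Fintype κ] [Fintype κ'] in
lemma rectSandwich_scalarTensor (a : Matrix κ ι ℂ) (P : Matrix ι ι' ℂ) (v : V)
    (b : Matrix ι' κ' ℂ) :
    rectSandwich a (scalarTensor P v) b = scalarTensor (a * P * b) v := by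
  ext i j
  simp only [rectSandwich, scalarTensor, Matrix.mul_apply, smul_smul, Finset.sum_mul,
    Finset.sum_smul]
  rw [Finset.sum_comm]
  refine Finset.sum_congr rfl fun k _ => Finset.sum_congr rfl fun l _ => ?_
  congr 1
  ring

lemma rectSandwich_submatrix [DecidableEq ι] [DecidableEq ι'] (A : Matrix ι ι' V) (f : μ → ι)
    (g : μ' → ι') :
    rectSandwich ((1 : Matrix ι ι ℂ).submatrix f id) A ((1 : Matrix ι' ι' ℂ).submatrix id g) =
      A.submatrix f g := by
  ext i j
  simp [rectSandwich, Matrix.one_apply]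

lemma rectSandwich_one [DecidableEq ι] [DecidableEq ι'] (A : Matrix ι ι' V) :
    rectSandwich (1 : Matrix ι ι ℂ) A (1 : Matrix ι' ι' ℂ) = A := by
  simpa using rectSandwich_submatrix A id id

omit [Fintype κ] [Fintype κ'] in
lemma conjTranspose_rectSandwich [StarAddMonoid V] [StarModule ℂ V] (a : Matrix κ ι ℂ)
    (A : Matrix ι ι' V) (b : Matrix ι' κ' ℂ) :
    (rectSandwich a A b)ᴴ = rectSandwich bᴴ Aᴴ aᴴ := by
  ext i j
  simp only [rectSandwich, Matrix.conjTranspose_apply, star_sum, star_smul]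
  rw [Finset.sum_comm]
  simp [mul_comm]

omit [Fintype ι] [Fintype ι'] in
lemma conjTranspose_scalarTensor [StarAddMonoid V] [StarModule ℂ V] (P : Matrix ι ι' ℂ)
    {v : V} (hv : IsSelfAdjoint v) : (scalarTensor P v)ᴴ = scalarTensor Pᴴ v := by
  ext i j
  simp [scalarTensor, star_smul, hv.star_eq]

lemma scaledUnit_eq (e : V) (n : ℕ) (r : ℝ) :
    scaledUnit e n r = scalarTensor ((r : ℂ) • (1 : Matrix (Fin n) (Fin n) ℂ)) e := by
  ext i j
  by_cases h : i = j <;> simp [scaledUnit, scalarTensor, h]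

end RectSandwich

/-! ### Cones over arbitrary finite index types -/

namespace LocalOperatorSystem

variable {Γ V : Type*} [AddCommGroup V] [Module ℂ V] [StarAddMonoid V] [StarModule ℂ V]
variable (𝒮 : LocalOperatorSystem Γ V) (α : Γ)
variable {ι κ : Type*} [Fintype ι] [Fintype κ]

/-- The cone of matrices over `V` with an arbitrary finite index type. -/
def coneOn (α : Γ) (ι : Type*) [Fintype ι] : PointedCone ℝ (Matrix ι ι V) where
  -- Testing against all compressions avoids choosing an enumeration of `ι`.
  carrier := {A | ∀ n (X : Matrix ι (Fin n) ℂ), rectSandwich Xᴴ A X ∈ 𝒮.cone α n}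
  add_mem' {A B} hA hB n X := by
    rw [rectSandwich_add]; exact add_mem (hA n X) (hB n X)
  zero_mem' n X := by
    have : rectSandwich Xᴴ (0 : Matrix ι ι V) X = 0 := by ext; simp [rectSandwich]
    rw [this]; exact zero_mem _
  smul_mem' c A hA n X := by
    have : rectSandwich Xᴴ (c • A) X = c • rectSandwich Xᴴ A X :=
      rectSandwich_smul _ ((c : ℝ) : ℂ) _ _
    rw [this]; exact Submodule.smul_mem _ c (hA n X)

variable {𝒮 α}

lemma mem_coneOn_fin {n : ℕ} {A : Matrix (Fin n) (Fin n) V} :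
    A ∈ 𝒮.coneOn α (Fin n) ↔ A ∈ 𝒮.cone α n := by
  refine ⟨fun h => ?_, fun h m X => 𝒮.compatible α n m X A h⟩
  have := h n 1
  rwa [Matrix.conjTranspose_one, rectSandwich_one] at this

lemma rectSandwich_mem {A : Matrix ι ι V} (hA : A ∈ 𝒮.coneOn α ι) (X : Matrix ι κ ℂ) :
    rectSandwich Xᴴ A X ∈ 𝒮.coneOn α κ := fun n Y => by
  rw [rectSandwich_rectSandwich, ← Matrix.conjTranspose_mul]
  exact hA n _

/-- Pulling back along any `f`, injective or not, is a congruence by a 0-1 matrix. -/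
lemma submatrix_mem {A : Matrix ι ι V} (hA : A ∈ 𝒮.coneOn α ι) (f : κ → ι) :
    A.submatrix f f ∈ 𝒮.coneOn α κ := by
  classical
  rw [← rectSandwich_submatrix A f f]
  have : ((1 : Matrix ι ι ℂ).submatrix f id) = ((1 : Matrix ι ι ℂ).submatrix id f)ᴴ := by
    ext i j; simp [Matrix.one_apply, eq_comm]
  rw [this]
  exact rectSandwich_mem hA _

lemma submatrix_equiv_mem {A : Matrix ι ι V} (e : κ ≃ ι) :
    A.submatrix e e ∈ 𝒮.coneOn α κ ↔ A ∈ 𝒮.coneOn α ι :=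
  ⟨fun h => by simpa using submatrix_mem h e.symm, fun h => submatrix_mem h e⟩

lemma blockMatrix_mem {m n : ℕ} {A : Matrix (Fin m) (Fin m) V} {B : Matrix (Fin m) (Fin n) V}
    {C : Matrix (Fin n) (Fin m) V} {D : Matrix (Fin n) (Fin n) V} :
    blockMatrix A B C D ∈ 𝒮.cone α (m + n) ↔
      Matrix.fromBlocks A B C D ∈ 𝒮.coneOn α (Fin m ⊕ Fin n) := by
  rw [← mem_coneOn_fin, blockMatrix, Matrix.reindex_apply, submatrix_equiv_mem]

lemma smul_mem_coneOn {A : Matrix ι ι V} (hA : A ∈ 𝒮.coneOn α ι) {r : ℝ} (hr : 0 ≤ r) :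
    (r : ℂ) • A ∈ 𝒮.coneOn α ι :=
  Submodule.smul_mem (𝒮.coneOn α ι) ⟨r, hr⟩ hA

lemma isHermitian_of_mem_coneOn {A : Matrix ι ι V} (hA : A ∈ 𝒮.coneOn α ι) : A.IsHermitian := by
  let e := Fintype.equivFin ι
  have := 𝒮.isHermitian_of_mem α _ _ (mem_coneOn_fin.1 (submatrix_mem hA e.symm))
  simpa using this.submatrix e

lemma exists_unit_sub_mem [DecidableEq ι] (A : Matrix ι ι V) (hA : A.IsHermitian) :
    ∃ r : ℝ, 0 < r ∧ scalarTensor ((r : ℂ) • (1 : Matrix ι ι ℂ)) 𝒮.unit - A ∈ 𝒮.coneOn α ι := by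
  let e := Fintype.equivFin ι
  obtain ⟨r, hr, h⟩ := 𝒮.orderUnit α _ _ (hA.submatrix e.symm)
  refine ⟨r, hr, ?_⟩
  rw [← mem_coneOn_fin, scaledUnit_eq] at h
  convert submatrix_mem h e using 1
  ext i j
  simp [scalarTensor, Matrix.one_apply]

lemma mem_coneOn_of_forall_pos [DecidableEq ι] {A : Matrix ι ι V}
    (h : ∀ r : ℝ, 0 < r →
      scalarTensor ((r : ℂ) • (1 : Matrix ι ι ℂ)) 𝒮.unit + A ∈ 𝒮.coneOn α ι) :
    A ∈ 𝒮.coneOn α ι := by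
  let e := Fintype.equivFin ι
  rw [← submatrix_equiv_mem e.symm, mem_coneOn_fin]
  refine 𝒮.archimedean α _ _ fun r hr => ?_
  rw [← mem_coneOn_fin, scaledUnit_eq]
  convert submatrix_mem (h r hr) e.symm using 1
  ext i j
  simp [scalarTensor, Matrix.one_apply]

/-- The order unit property at `A = 0` makes some `r e` with `r > 0` positive; divide by `r`. -/
lemma scalarTensor_one_mem [DecidableEq ι] :
    scalarTensor (1 : Matrix ι ι ℂ) 𝒮.unit ∈ 𝒮.coneOn α ι := by
  obtain ⟨r, hr, h⟩ := exists_unit_sub_mem (𝒮 := 𝒮) (α := α) (0 : Matrix ι ι V)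
    Matrix.isHermitian_zero
  have := smul_mem_coneOn h (inv_nonneg.2 hr.le)
  convert this using 1
  ext i j
  have : (r : ℂ) ≠ 0 := by exact_mod_cast hr.ne'
  simp [scalarTensor, smul_smul, this]

lemma scalarTensor_conjTranspose_mul_self_mem (X : Matrix κ ι ℂ) :
    scalarTensor (Xᴴ * X) 𝒮.unit ∈ 𝒮.coneOn α ι := by
  classical
  have := rectSandwich_mem (scalarTensor_one_mem (𝒮 := 𝒮) (α := α) (ι := κ)) X
  rwa [rectSandwich_scalarTensor, Matrix.mul_one] at this

open scoped Matrix.Norms.L2Operator MatrixOrder in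
lemma _root_.Matrix.PosSemidef.exists_eq_conjTranspose_mul_self [DecidableEq ι]
    {P : Matrix ι ι ℂ} (hP : P.PosSemidef) : ∃ X : Matrix ι ι ℂ, P = Xᴴ * X :=
  CStarAlgebra.nonneg_iff_eq_star_mul_self.1 (Matrix.nonneg_iff_posSemidef.2 hP)

lemma scalarTensor_mem {P : Matrix ι ι ℂ} (hP : P.PosSemidef) :
    scalarTensor P 𝒮.unit ∈ 𝒮.coneOn α ι := by
  classical
  obtain ⟨X, rfl⟩ := hP.exists_eq_conjTranspose_mul_self
  exact scalarTensor_conjTranspose_mul_self_mem X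

lemma fromBlocks_diagonal_mem {A : Matrix ι ι V} {B : Matrix κ κ V} (hA : A ∈ 𝒮.coneOn α ι)
    (hB : B ∈ 𝒮.coneOn α κ) : Matrix.fromBlocks A 0 0 B ∈ 𝒮.coneOn α (ι ⊕ κ) := by
  classical
  have h1 := rectSandwich_mem hA (Matrix.fromCols (1 : Matrix ι ι ℂ) (0 : Matrix ι κ ℂ))
  have h2 := rectSandwich_mem hB (Matrix.fromCols (0 : Matrix κ ι ℂ) (1 : Matrix κ κ ℂ))
  convert add_mem h1 h2 using 1
  ext (i | i) (j | j) <;> simp [rectSandwich, Matrix.one_apply]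

lemma fromBlocks_congr_mem {κ' ι' : Type*} [Fintype κ'] [Fintype ι'] {A : Matrix ι ι V}
    {B : Matrix ι κ V} {C : Matrix κ ι V} {D : Matrix κ κ V}
    (h : Matrix.fromBlocks A B C D ∈ 𝒮.coneOn α (ι ⊕ κ)) (X : Matrix ι ι' ℂ) (Y : Matrix κ κ' ℂ) :
    Matrix.fromBlocks (rectSandwich Xᴴ A X) (rectSandwich Xᴴ B Y) (rectSandwich Yᴴ C X)
      (rectSandwich Yᴴ D Y) ∈ 𝒮.coneOn α (ι' ⊕ κ') := by
  convert rectSandwich_mem h (Matrix.fromBlocks X 0 0 Y) using 1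
  ext (i | i) (j | j) <;> simp [rectSandwich]

end LocalOperatorSystem

-- The C*-inequality `a^* a ≤ ‖a‖²`, with slack so that `s` can be taken strictly positive.
open scoped Matrix.Norms.L2Operator MatrixOrder in
lemma Matrix.posSemidef_smul_one_sub_conjTranspose_mul_self {ι κ : Type*} [Fintype ι] [Fintype κ]
    [DecidableEq ι] [DecidableEq κ] (a : Matrix κ ι ℂ) {s : ℝ} (hs : ‖a‖ ≤ s) :
    (((s ^ 2 : ℝ) : ℂ) • (1 : Matrix ι ι ℂ) - aᴴ * a).PosSemidef := by
  have h1 : aᴴ * a ≤ algebraMap ℝ (Matrix ι ι ℂ) ‖aᴴ * a‖ :=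
    IsSelfAdjoint.le_algebraMap_norm_self (Matrix.isHermitian_conjTranspose_mul_self a)
  rw [Matrix.l2_opNorm_conjTranspose_mul_self, Matrix.le_iff] at h1
  have h2 : (((s ^ 2 - ‖a‖ * ‖a‖ : ℝ) : ℂ) • (1 : Matrix ι ι ℂ)).PosSemidef := by
    refine Matrix.PosSemidef.one.smul ?_
    have : ‖a‖ * ‖a‖ ≤ s ^ 2 := by nlinarith [norm_nonneg a]
    exact_mod_cast sub_nonneg.2 this
  have h3 : ((s ^ 2 : ℝ) : ℂ) • (1 : Matrix ι ι ℂ) - aᴴ * a =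
      algebraMap ℝ (Matrix ι ι ℂ) (‖a‖ * ‖a‖) - aᴴ * a +
        ((s ^ 2 - ‖a‖ * ‖a‖ : ℝ) : ℂ) • (1 : Matrix ι ι ℂ) := by
    rw [Algebra.algebraMap_eq_smul_one, ← Complex.coe_smul]
    push_cast
    module
  rw [h3]
  exact h1.add h2

lemma blockMatrix_apply {V : Type*} {m n : ℕ} (A : Matrix (Fin m) (Fin m) V)
    (B : Matrix (Fin m) (Fin n) V) (C : Matrix (Fin n) (Fin m) V) (D : Matrix (Fin n) (Fin n) V)
    (x y : Fin m ⊕ Fin n) : blockMatrix A B C D (finSumFinEquiv x) (finSumFinEquiv y) =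
      Matrix.fromBlocks A B C D x y := by
  simp [blockMatrix]

lemma tensorMatrix_apply {V W : Type*} [AddCommGroup V] [Module ℂ V] [AddCommGroup W] [Module ℂ W]
    {n m : ℕ} (A : Matrix (Fin n) (Fin n) V) (B : Matrix (Fin m) (Fin m) W)
    (x y : Fin n × Fin m) : tensorMatrix A B (finProdFinEquiv x) (finProdFinEquiv y) =
      A x.1 y.1 ⊗ₜ[ℂ] B x.2 y.2 := by
  simp [tensorMatrix]

/-! ### The induced matrix seminorms -/

namespace LocalOperatorSystem

variable {Γ V : Type*} [AddCommGroup V] [Module ℂ V] [StarAddMonoid V] [StarModule ℂ V]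
variable {𝒮 : LocalOperatorSystem Γ V} {α : Γ}
variable {ι κ : Type*} [Fintype ι] [Fintype κ] [DecidableEq ι] [DecidableEq κ]

/-- The block matrix with diagonal `r e`, `r e` and off-diagonal `A`, `A^*` is positive. -/
def IsNormBound (𝒮 : LocalOperatorSystem Γ V) (α : Γ) (A : Matrix ι ι V) (r : ℝ) : Prop :=
  Matrix.fromBlocks (scalarTensor ((r : ℂ) • (1 : Matrix ι ι ℂ)) 𝒮.unit) A Aᴴ
    (scalarTensor ((r : ℂ) • (1 : Matrix ι ι ℂ)) 𝒮.unit) ∈ 𝒮.coneOn α (ι ⊕ ι)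

lemma isNormBound_iff {n : ℕ} {A : Matrix (Fin n) (Fin n) V} {r : ℝ} :
    blockMatrix (scaledUnit 𝒮.unit n r) A Aᴴ (scaledUnit 𝒮.unit n r) ∈ 𝒮.cone α (n + n) ↔
      𝒮.IsNormBound α A r := by
  rw [blockMatrix_mem, scaledUnit_eq, IsNormBound]

lemma IsNormBound.mono {A : Matrix ι ι V} {r s : ℝ} (h : 𝒮.IsNormBound α A r) (hrs : r ≤ s) :
    𝒮.IsNormBound α A s := by
  have := smul_mem_coneOn (scalarTensor_one_mem (𝒮 := 𝒮) (α := α) (ι := ι ⊕ ι))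
    (sub_nonneg.2 hrs)
  unfold IsNormBound
  convert add_mem h this using 1
  ext (i | i) (j | j) <;> by_cases hij : i = j <;>
    simp [scalarTensor, hij, sub_smul]

/-- Ensures that the infimum defining the seminorm is not the default value of `sInf ∅`. -/
lemma exists_isNormBound (𝒮 : LocalOperatorSystem Γ V) (α : Γ) (A : Matrix ι ι V) :
    ∃ r, 0 ≤ r ∧ 𝒮.IsNormBound α A r := by
  obtain ⟨r, hr, h⟩ := exists_unit_sub_mem (𝒮 := 𝒮) (α := α) (Matrix.fromBlocks 0 (-A) (-Aᴴ) 0)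
    (by simp [Matrix.IsHermitian, Matrix.fromBlocks_conjTranspose])
  refine ⟨r, hr.le, ?_⟩
  unfold IsNormBound
  convert h using 1
  ext (i | i) (j | j) <;> by_cases hij : i = j <;>
    simp [scalarTensor, hij]

lemma IsNormBound.of_forall_gt {A : Matrix ι ι V} {r : ℝ}
    (h : ∀ s, r < s → 𝒮.IsNormBound α A s) : 𝒮.IsNormBound α A r := by
  refine mem_coneOn_of_forall_pos fun ε hε => ?_
  have h1 := h (r + ε) (by linarith)
  unfold IsNormBound at h1
  convert h1 using 1
  ext (i | i) (j | j) <;> by_cases hij : i = j <;>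
    simp [scalarTensor, hij, add_smul, add_comm]

lemma seminorm_nonneg (𝒮 : LocalOperatorSystem Γ V) (α : Γ) (n : ℕ)
    (A : Matrix (Fin n) (Fin n) V) : 0 ≤ 𝒮.seminorm α n A :=
  Real.sInf_nonneg fun _ h => h.1

lemma seminorm_le {n : ℕ} {A : Matrix (Fin n) (Fin n) V} {r : ℝ} (hr : 0 ≤ r)
    (h : 𝒮.IsNormBound α A r) : 𝒮.seminorm α n A ≤ r :=
  csInf_le ⟨0, fun _ h => h.1⟩ ⟨hr, isNormBound_iff.2 h⟩

/-- The infimum is attained, by the Archimedean axiom; seminorm estimates thereby become cone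
memberships. -/
lemma isNormBound_seminorm (𝒮 : LocalOperatorSystem Γ V) (α : Γ) {n : ℕ}
    (A : Matrix (Fin n) (Fin n) V) : 𝒮.IsNormBound α A (𝒮.seminorm α n A) := by
  refine IsNormBound.of_forall_gt fun s hs => ?_
  obtain ⟨r, hr, h⟩ := exists_isNormBound 𝒮 α A
  unfold seminorm at hs
  obtain ⟨t, ht, hts⟩ := exists_lt_of_csInf_lt ⟨r, And.intro hr (isNormBound_iff.2 h)⟩ hs
  exact (isNormBound_iff.1 ht.2).mono hts.le

lemma IsNormBound.add {A B : Matrix ι ι V} {r s : ℝ} (hA : 𝒮.IsNormBound α A r)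
    (hB : 𝒮.IsNormBound α B s) : 𝒮.IsNormBound α (A + B) (r + s) := by
  unfold IsNormBound
  convert add_mem hA hB using 1
  ext (i | i) (j | j) <;> by_cases hij : i = j <;>
    simp [scalarTensor, hij, add_smul]

lemma IsNormBound.submatrix {A : Matrix ι ι V} {r : ℝ} (hA : 𝒮.IsNormBound α A r)
    {f : κ → ι} (hf : Function.Injective f) : 𝒮.IsNormBound α (A.submatrix f f) r := by
  unfold IsNormBound
  convert submatrix_mem hA (Sum.map f f) using 1
  ext (i | i) (j | j) <;>
    simp [scalarTensor, Matrix.one_apply, hf.eq_iff]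

lemma IsNormBound.fromBlocks {A : Matrix ι ι V} {B : Matrix κ κ V} {r : ℝ}
    (hA : 𝒮.IsNormBound α A r) (hB : 𝒮.IsNormBound α B r) :
    𝒮.IsNormBound α (Matrix.fromBlocks A 0 0 B) r := by
  unfold IsNormBound
  convert submatrix_mem (fromBlocks_diagonal_mem hA hB) (Equiv.sumSumSumComm ι κ ι κ) using 1
  ext ((i | i) | (i | i)) ((j | j) | (j | j)) <;>
    simp [scalarTensor, Matrix.one_apply]

-- Conjugating by `c a^* ⊕ c⁻¹ b` keeps the corner `a A b` and makes the diagonal `r c² a a^*`, `r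
-- c⁻² b^* b`. With `c² s = t` both are at most `s r t`; the positive differences, tensored with
-- `e`, are added back.
open scoped Matrix.Norms.L2Operator in
lemma IsNormBound.mul_mul {A : Matrix ι ι V} {r s t : ℝ} (hr : 0 ≤ r)
    (hA : 𝒮.IsNormBound α A r) {a : Matrix κ ι ℂ} {b : Matrix ι κ ℂ} (hs : 0 < s) (ht : 0 < t)
    (ha : ‖a‖ ≤ s) (hb : ‖b‖ ≤ t) : 𝒮.IsNormBound α (rectSandwich a A b) (s * r * t) := by
  have hc : ∃ c : ℝ, c ≠ 0 ∧ c ^ 2 * s = t :=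
    ⟨√(t / s), (Real.sqrt_pos.2 (by positivity)).ne', by
      rw [Real.sq_sqrt (by positivity)]; field_simp⟩
  obtain ⟨c, hc0, hc⟩ := hc
  have h1 := fromBlocks_congr_mem hA ((c : ℂ) • aᴴ) (((c⁻¹ : ℝ) : ℂ) • b)
  have hP := (Matrix.posSemidef_smul_one_sub_conjTranspose_mul_self aᴴ
    (show ‖aᴴ‖ ≤ s by rwa [Matrix.l2_opNorm_conjTranspose])).smul
    (show (0 : ℂ) ≤ ((r * c ^ 2 : ℝ) : ℂ) by exact_mod_cast (by positivity))
  have hQ := (Matrix.posSemidef_smul_one_sub_conjTranspose_mul_self b hb).smul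
    (show (0 : ℂ) ≤ ((r * c⁻¹ ^ 2 : ℝ) : ℂ) by exact_mod_cast (by positivity))
  have h2 := fromBlocks_diagonal_mem (scalarTensor_mem (𝒮 := 𝒮) (α := α) hP)
    (scalarTensor_mem (𝒮 := 𝒮) (α := α) hQ)
  have h3 := add_mem h1 h2
  have hcC : (c : ℂ) ≠ 0 := by exact_mod_cast hc0
  have hcs : (c : ℂ) ^ 2 * s = t := by exact_mod_cast hc
  have e1 : ((s * r * t : ℝ) : ℂ) • (1 : Matrix κ κ ℂ) =
      ((c : ℂ) • aᴴ)ᴴ * ((r : ℂ) • (1 : Matrix ι ι ℂ)) * ((c : ℂ) • aᴴ) +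
        ((r * c ^ 2 : ℝ) : ℂ) • (((s ^ 2 : ℝ) : ℂ) • (1 : Matrix κ κ ℂ) - aᴴᴴ * aᴴ) := by
    simp only [Matrix.conjTranspose_smul, Matrix.conjTranspose_conjTranspose, Matrix.smul_mul,
      Matrix.mul_smul, Matrix.mul_one, smul_smul, smul_sub]
    simp [← hcs]
    match_scalars <;> ring
  have e2 : ((s * r * t : ℝ) : ℂ) • (1 : Matrix κ κ ℂ) =
      (((c⁻¹ : ℝ) : ℂ) • b)ᴴ * ((r : ℂ) • (1 : Matrix ι ι ℂ)) * (((c⁻¹ : ℝ) : ℂ) • b) +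
        ((r * c⁻¹ ^ 2 : ℝ) : ℂ) • (((t ^ 2 : ℝ) : ℂ) • (1 : Matrix κ κ ℂ) - bᴴ * b) := by
    simp only [Matrix.conjTranspose_smul, Matrix.smul_mul,
      Matrix.mul_smul, Matrix.mul_one, smul_smul, smul_sub]
    simp [← hcs]
    match_scalars
    · field_simp
    · ring
  have e3 : rectSandwich ((c : ℂ) • aᴴ)ᴴ A (((c⁻¹ : ℝ) : ℂ) • b) = rectSandwich a A b := by
    ext i j
    refine Finset.sum_congr rfl fun k _ => Finset.sum_congr rfl fun l _ => ?_
    simp only [Matrix.conjTranspose_apply, Matrix.smul_apply, smul_eq_mul, star_mul',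
      Complex.star_def, Complex.conj_ofReal, Complex.conj_conj]
    congr 1
    push_cast
    field_simp
  have e4 := congrArg Matrix.conjTranspose e3
  rw [conjTranspose_rectSandwich, Matrix.conjTranspose_conjTranspose] at e4
  unfold IsNormBound
  rw [rectSandwich_scalarTensor, rectSandwich_scalarTensor, e3, e4, Matrix.fromBlocks_add,
    ← scalarTensor_add, ← scalarTensor_add, add_zero, add_zero, ← e1, ← e2] at h3
  exact h3

/-- With zero diagonal, conjugation by `1 ⊕ (-1)` negates the block matrix, so both signs lie in
every cone. -/
lemma eq_zero_of_isNormBound {n : ℕ} {A : Matrix (Fin n) (Fin n) V}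
    (h : ∀ α, 𝒮.IsNormBound α A 0) : A = 0 := by
  have key : blockMatrix (0 : Matrix (Fin n) (Fin n) V) A Aᴴ 0 = 0 := by
    refine 𝒮.eq_zero_of_mem _ _ fun α => ?_
    have h1 := h α
    simp only [IsNormBound, Complex.ofReal_zero, zero_smul] at h1
    have h0 : scalarTensor (0 : Matrix (Fin n) (Fin n) ℂ) 𝒮.unit = 0 := by
      ext; simp [scalarTensor]
    rw [h0] at h1
    refine ⟨blockMatrix_mem.2 h1, ?_⟩
    have h2 := fromBlocks_congr_mem h1 (1 : Matrix (Fin n) (Fin n) ℂ) (-1 : Matrix (Fin n) (Fin n) ℂ)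
    have h3 : -blockMatrix (0 : Matrix (Fin n) (Fin n) V) A Aᴴ 0 = blockMatrix 0 (-A) (-Aᴴ) 0 := by
      unfold blockMatrix
      rw [← neg_zero, ← Matrix.fromBlocks_neg]
      simp [Matrix.reindex_apply]
      rfl
    rw [h3, blockMatrix_mem]
    convert h2 using 1
    ext (i | i) (j | j) <;> simp [rectSandwich, Matrix.one_apply]
  ext i j
  have := congrFun (congrFun key (finSumFinEquiv (Sum.inl i))) (finSumFinEquiv (Sum.inr j))
  simpa [blockMatrix_apply, -finSumFinEquiv_apply_left, -finSumFinEquiv_apply_right] using this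

-- Only an inequality, since the norm is `0` for an empty index type.
open scoped Matrix.Norms.L2Operator in
lemma _root_.Matrix.l2_opNorm_one_le : ‖(1 : Matrix ι ι ℂ)‖ ≤ 1 := by
  rw [← Matrix.diagonal_one, Matrix.l2_opNorm_diagonal]
  exact (pi_norm_le_iff_of_nonneg zero_le_one).2 fun _ => by simp

open scoped Matrix.Norms.L2Operator in
lemma seminorm_sandwich_le (𝒮 : LocalOperatorSystem Γ V) (α : Γ) {m n : ℕ}
    (a : Matrix (Fin n) (Fin m) ℂ) (A : Matrix (Fin m) (Fin m) V) (b : Matrix (Fin m) (Fin n) ℂ) :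
    𝒮.seminorm α n (sandwich a A b) ≤ ‖a‖ * 𝒮.seminorm α m A * ‖b‖ := by
  -- The scaling in `IsNormBound.mul_mul` divides by the bounds, which must therefore be positive
  -- even when `a` or `b` is zero.
  have key : ∀ ε : ℝ, 0 < ε → 𝒮.seminorm α n (sandwich a A b) ≤
      (‖a‖ + ε) * 𝒮.seminorm α m A * (‖b‖ + ε) := fun ε hε => by
    have hp := 𝒮.seminorm_nonneg α m A
    exact seminorm_le (by positivity) ((𝒮.isNormBound_seminorm α A).mul_mul hp
      (by positivity) (by positivity) (by linarith) (by linarith))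
  have hc : Filter.Tendsto (fun ε : ℝ => (‖a‖ + ε) * 𝒮.seminorm α m A * (‖b‖ + ε))
      (nhdsWithin 0 (Set.Ioi 0)) (nhds ((‖a‖ + 0) * 𝒮.seminorm α m A * (‖b‖ + 0))) :=
    (Continuous.tendsto (by fun_prop) 0).mono_left nhdsWithin_le_nhds
  simp only [add_zero] at hc
  exact ge_of_tendsto hc (eventually_nhdsWithin_of_forall key)

open scoped Matrix.Norms.L2Operator in
lemma seminorm_smul_le (𝒮 : LocalOperatorSystem Γ V) (α : Γ) {n : ℕ} (c : ℂ)
    (A : Matrix (Fin n) (Fin n) V) : 𝒮.seminorm α n (c • A) ≤ ‖c‖ * 𝒮.seminorm α n A := by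
  have h := 𝒮.seminorm_sandwich_le α (c • (1 : Matrix (Fin n) (Fin n) ℂ)) A 1
  have e : sandwich (c • (1 : Matrix (Fin n) (Fin n) ℂ)) A 1 = c • A := by
    ext i j; simp [sandwich, Matrix.one_apply]
  have h1 := Matrix.l2_opNorm_one_le (ι := Fin n)
  have hp := 𝒮.seminorm_nonneg α n A
  rw [e, norm_smul] at h
  refine h.trans ?_
  calc ‖c‖ * ‖(1 : Matrix (Fin n) (Fin n) ℂ)‖ * 𝒮.seminorm α n A * ‖(1 : Matrix (Fin n) (Fin n) ℂ)‖
      ≤ ‖c‖ * 1 * 𝒮.seminorm α n A * 1 := by gcongr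
    _ = _ := by ring

theorem isLocalOperatorSpace (𝒮 : LocalOperatorSystem Γ V) :
    IsLocalOperatorSpace 𝒮.seminorm where
  nonneg := 𝒮.seminorm_nonneg
  add_le α n A B := seminorm_le
    (add_nonneg (𝒮.seminorm_nonneg α n A) (𝒮.seminorm_nonneg α n B))
    ((𝒮.isNormBound_seminorm α A).add (𝒮.isNormBound_seminorm α B))
  smul_eq α n c A := by
    refine le_antisymm (𝒮.seminorm_smul_le α c A) ?_
    rcases eq_or_ne c 0 with rfl | hc
    · simpa using 𝒮.seminorm_nonneg α n _
    · have := 𝒮.seminorm_smul_le α c⁻¹ (c • A)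
      rw [inv_smul_smul₀ hc, norm_inv] at this
      rwa [mul_comm, ← le_div_iff₀ (norm_pos_iff.2 hc), div_eq_inv_mul]
  directSum α m n A B := by
    refine le_antisymm (seminorm_le (le_max_of_le_left (𝒮.seminorm_nonneg α m A)) ?_)
      (max_le ?_ ?_)
    · exact (((𝒮.isNormBound_seminorm α A).mono (le_max_left _ _)).fromBlocks
        ((𝒮.isNormBound_seminorm α B).mono (le_max_right _ _))).submatrix
        finSumFinEquiv.symm.injective
    · refine seminorm_le (𝒮.seminorm_nonneg α _ _) ?_
      convert (𝒮.isNormBound_seminorm α (blockMatrix A 0 0 B)).submatrix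
        (finSumFinEquiv.injective.comp Sum.inl_injective) using 1
      ext i j; simp [blockMatrix]
    · refine seminorm_le (𝒮.seminorm_nonneg α _ _) ?_
      convert (𝒮.isNormBound_seminorm α (blockMatrix A 0 0 B)).submatrix
        (finSumFinEquiv.injective.comp Sum.inr_injective) using 1
      ext i j; simp [blockMatrix]
  sandwich_le α m n a A b := 𝒮.seminorm_sandwich_le α a A b
  separated n A h := eq_zero_of_isNormBound fun α => h α ▸ 𝒮.isNormBound_seminorm α A

lemma seminorm_tensorMatrix_le {Λ Δ W : Type*} [AddCommGroup W] [Module ℂ W] [StarAddMonoid W]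
    [StarModule ℂ W] {𝒯 : LocalOperatorSystem Λ W} {τ : LocalOperatorSystem Δ (V ⊗[ℂ] W)}
    (hu : τ.unit = 𝒮.unit ⊗ₜ[ℂ] 𝒯.unit) {β : Λ} {γ : Δ}
    (h : ∀ n m, ∀ P ∈ 𝒮.cone α n, ∀ Q ∈ 𝒯.cone β m, tensorMatrix P Q ∈ τ.cone γ (n * m))
    {n m : ℕ} (A : Matrix (Fin n) (Fin n) V) (B : Matrix (Fin m) (Fin m) W) :
    τ.seminorm γ (n * m) (tensorMatrix A B) ≤ 𝒮.seminorm α n A * 𝒯.seminorm β m B := by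
  refine seminorm_le (mul_nonneg (𝒮.seminorm_nonneg α n A) (𝒯.seminorm_nonneg β m B)) ?_
  have h1 := h _ _ _ (isNormBound_iff.2 (𝒮.isNormBound_seminorm α A)) _
    (isNormBound_iff.2 (𝒯.isNormBound_seminorm β B))
  -- Of the four diagonal corners of the tensor product keep (first, first) and (second, second):
  -- the off-diagonal block between them is `A ⊗ B`.
  have h2 := submatrix_mem (mem_coneOn_fin.2 h1)
    (Sum.elim
      (fun x : Fin (n * m) => finProdFinEquiv
        (finSumFinEquiv (Sum.inl (finProdFinEquiv.symm x).1),
          finSumFinEquiv (Sum.inl (finProdFinEquiv.symm x).2)))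
      (fun x : Fin (n * m) => finProdFinEquiv
        (finSumFinEquiv (Sum.inr (finProdFinEquiv.symm x).1),
          finSumFinEquiv (Sum.inr (finProdFinEquiv.symm x).2))))
  unfold IsNormBound
  convert h2 using 1
  ext i j
  rcases i with i | i <;> rcases j with j | j <;>
    obtain ⟨⟨i1, i2⟩, rfl⟩ := finProdFinEquiv.surjective i <;>
    obtain ⟨⟨j1, j2⟩, rfl⟩ := finProdFinEquiv.surjective j <;>
    simp only [Matrix.submatrix_apply, Sum.elim_inl, Sum.elim_inr, tensorMatrix_apply,
      blockMatrix_apply, Equiv.symm_apply_apply, Matrix.fromBlocks_apply₁₁,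
      Matrix.fromBlocks_apply₁₂, Matrix.fromBlocks_apply₂₁, Matrix.fromBlocks_apply₂₂,
      Matrix.conjTranspose_apply, TensorProduct.star_tmul, scaledUnit_eq, scalarTensor, hu,
      Matrix.smul_apply, Matrix.one_apply, finProdFinEquiv.injective.eq_iff, Prod.mk.injEq,
      TensorProduct.smul_tmul', TensorProduct.tmul_smul, smul_smul] <;>
    by_cases h1 : i1 = j1 <;> by_cases h2 : i2 = j2 <;> simp [h1, h2, mul_comm]

end LocalOperatorSystem

/-! ### Extension of positive functionals -/

/-- M. Riesz extension for complex linear functionals, with the extended functional given by a pair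
of linear maps `j : W → E`, `G : W → ℂ`. -/
theorem exists_complex_extension_nonneg {E W : Type*} [AddCommGroup E] [Module ℂ E]
    [AddCommGroup W] [Module ℂ W] (s : PointedCone ℝ E) (j : W →ₗ[ℂ] E) (G : W →ₗ[ℂ] ℂ)
    (nonneg : ∀ w, j w ∈ s → 0 ≤ (G w).re) (dense : ∀ y, ∃ w, j w + y ∈ s) :
    ∃ F : E →ₗ[ℂ] ℂ, (∀ w, F (j w) = G w) ∧ ∀ x ∈ s, 0 ≤ (F x).re := by
  -- On `ker j` every complex multiple of `w` is mapped into `s`; the multiple by `-conj (G w)`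
  -- gives `-‖G w‖² ≥ 0`.
  have hker : LinearMap.ker j ≤ LinearMap.ker G := fun w hw => by
    have h1 := nonneg (-(starRingEnd ℂ (G w)) • w) (by
      rw [map_smul, LinearMap.mem_ker.1 hw, smul_zero]; exact zero_mem _)
    rw [map_smul, smul_eq_mul, neg_mul, Complex.conj_mul'] at h1
    rw [LinearMap.mem_ker, ← norm_eq_zero]
    have h2 : (-((‖G w‖ : ℂ) ^ 2)).re = -‖G w‖ ^ 2 := by norm_cast
    rw [h2] at h1
    exact pow_eq_zero_iff two_ne_zero |>.1 (le_antisymm (by linarith) (sq_nonneg _))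
  obtain ⟨g, hg⟩ := LinearMap.exists_extend
    ((LinearMap.ker j).liftQ G hker ∘ₗ j.quotKerEquivRange.symm.toLinearMap)
  have hgj : ∀ w, g (j w) = G w := fun w => by
    have := LinearMap.congr_fun hg ⟨j w, LinearMap.mem_range_self j w⟩
    simpa [LinearMap.quotKerEquivRange_symm_apply_image] using this
  let f : E →ₗ.[ℝ] ℝ := (Complex.reLm ∘ₗ g.restrictScalars ℝ).toPMap
    ((LinearMap.range j).restrictScalars ℝ)
  obtain ⟨h, hf, hs⟩ := riesz_extension s f
    (by
      rintro ⟨_, w, rfl⟩ hx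
      simpa [f, hgj] using nonneg w hx)
    (fun y => by
      obtain ⟨w, hw⟩ := dense y
      exact ⟨⟨j w, w, rfl⟩, hw⟩)
  have hj : ∀ w, h (j w) = (G w).re := fun w => by
    have := hf ⟨j w, w, rfl⟩
    simpa [f, hgj] using this
  refine ⟨Module.Dual.extendRCLike (𝕜 := ℂ) h, fun w => ?_, fun x hx => ?_⟩
  · apply Complex.ext
    · rw [← hj, ← RCLike.re_eq_complex_re, Module.Dual.re_extendRCLike_apply]
    · rw [← RCLike.im_eq_complex_im, Module.Dual.im_extendRCLike_apply, ← map_smul, hj]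
      simp
  · rw [← RCLike.re_eq_complex_re, Module.Dual.re_extendRCLike_apply]
    exact hs x hx

/-! ### Norm and positivity estimates for scalar matrices -/

namespace Matrix

variable {ι κ : Type*} [Fintype ι] [Fintype κ]

/-- A complex matrix is positive semidefinite if its quadratic form is nonnegative. -/
lemma posSemidef_of_forall_nonneg {M : Matrix ι ι ℂ} (h : ∀ x : ι → ℂ, 0 ≤ star x ⬝ᵥ M *ᵥ x) :
    M.PosSemidef := by
  classical
  have : M.toEuclideanLin.IsPositive := by
    rw [LinearMap.isPositive_iff_complex]
    intro x
    have h1 : inner ℂ (M.toEuclideanLin x) x = star (star x.ofLp ⬝ᵥ M *ᵥ x.ofLp) := by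
      rw [EuclideanSpace.inner_eq_star_dotProduct, Matrix.star_dotProduct]
      simp [dotProduct_comm]
    obtain ⟨r, hr, hr2⟩ := RCLike.nonneg_iff_exists_ofReal.1 (h x)
    rw [h1, ← hr2]
    simpa using hr
  exact Matrix.isPositive_toEuclideanLin_iff.1 this

-- Cauchy–Schwarz followed by `2‖u‖‖w‖ ≤ ‖u‖² + ‖w‖²`.
open scoped Matrix.Norms.L2Operator in
lemma re_star_dotProduct_mulVec_bound [DecidableEq κ] {M : Matrix ι κ ℂ} (hM : ‖M‖ ≤ 1)
    (u : ι → ℂ) (w : κ → ℂ) :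
    0 ≤ (∑ i, ‖u i‖ ^ 2) + (∑ j, ‖w j‖ ^ 2) + 2 * (star u ⬝ᵥ M *ᵥ w).re := by
  set U : EuclideanSpace ℂ ι := WithLp.toLp 2 u
  set W : EuclideanSpace ℂ κ := WithLp.toLp 2 w
  have h1 : star u ⬝ᵥ M *ᵥ w = inner ℂ U (WithLp.toLp 2 (M *ᵥ w)) := by
    rw [EuclideanSpace.inner_eq_star_dotProduct, dotProduct_comm]
  have h2 : ‖WithLp.toLp 2 (M *ᵥ w)‖ ≤ ‖W‖ := by
    have := Matrix.l2_opNorm_mulVec M W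
    exact this.trans (mul_le_of_le_one_left (norm_nonneg _) hM)
  have h3 : ∑ i, ‖u i‖ ^ 2 = ‖U‖ ^ 2 := (EuclideanSpace.norm_sq_eq U).symm
  have h4 : ∑ i, ‖w i‖ ^ 2 = ‖W‖ ^ 2 := (EuclideanSpace.norm_sq_eq W).symm
  have h5 := (Complex.abs_re_le_norm _).trans (norm_inner_le_norm (𝕜 := ℂ) U (WithLp.toLp 2 (M *ᵥ w)))
  have h6 := neg_le_of_abs_le h5
  rw [h1, h3, h4]
  nlinarith [norm_nonneg U, norm_nonneg W, sq_nonneg (‖U‖ - ‖W‖),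
    mul_le_mul_of_nonneg_left h2 (norm_nonneg U)]

open scoped Matrix.Norms.L2Operator in
/-- The off-diagonal block of a positive semidefinite matrix with diagonal blocks `r`. -/
lemma PosSemidef.norm_offDiagonal_le [DecidableEq ι] {Y Z : Matrix ι ι ℂ} {r : ℝ} (hr : 0 < r)
    (h : (fromBlocks ((r : ℂ) • (1 : Matrix ι ι ℂ)) Y Z ((r : ℂ) • (1 : Matrix ι ι ℂ))).PosSemidef) :
    ‖Y‖ ≤ r := by
  have hZ : Z = Yᴴ := by
    have := h.isHermitian
    rw [isHermitian_fromBlocks_iff] at this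
    exact this.2.1.symm
  subst hZ
  rw [Matrix.l2_opNorm_def]
  refine ContinuousLinearMap.opNorm_le_bound _ hr.le fun v => ?_
  set y : ι → ℂ := Y *ᵥ v.ofLp with hy
  -- At the test vector `(Y v, -r v)` the quadratic form equals `-r ‖Y v‖² + r³ ‖v‖²`.
  have hq := h.dotProduct_mulVec_nonneg (Sum.elim y (fun i => -((r : ℂ) * v.ofLp i)))
  have e1 : ((toEuclideanLin (𝕜 := ℂ) (m := ι) (n := ι)).trans LinearMap.toContinuousLinearMap Y) v
      = WithLp.toLp 2 y := rfl
  rw [e1]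
  have hv : (fun i => -((r : ℂ) * v.ofLp i)) = -((r : ℂ) • v.ofLp) := by ext; simp
  have e2 : star (Sum.elim y (-((r : ℂ) • v.ofLp))) = Sum.elim (star y) (-((r : ℂ) • star v.ofLp)) := by
    ext (i | i) <;> simp
  rw [hv, fromBlocks_mulVec, e2, sumElim_dotProduct_sumElim] at hq
  have e3 : star v.ofLp ⬝ᵥ Yᴴ *ᵥ y = star y ⬝ᵥ y := by
    rw [dotProduct_mulVec, ← star_mulVec]
  have n1 : star y ⬝ᵥ y = ((‖WithLp.toLp 2 y‖ ^ 2 : ℝ) : ℂ) := by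
    rw [EuclideanSpace.norm_sq_eq]
    simp [dotProduct, Complex.conj_mul']
  have n2 : star v.ofLp ⬝ᵥ v.ofLp = ((‖v‖ ^ 2 : ℝ) : ℂ) := by
    rw [EuclideanSpace.norm_sq_eq]
    simp [dotProduct, Complex.conj_mul']
  simp only [smul_mulVec, one_mulVec, mulVec_neg, mulVec_smul, dotProduct_add, dotProduct_neg,
    neg_dotProduct, smul_dotProduct, dotProduct_smul, ← hy, e3, n1, n2, smul_eq_mul,
    Sum.elim_comp_inl, Sum.elim_comp_inr] at hq
  have hq' : 0 ≤ -r * ‖WithLp.toLp 2 y‖ ^ 2 + r ^ 3 * ‖v‖ ^ 2 := by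
    have : (0 : ℂ) ≤ ((-r * ‖WithLp.toLp 2 y‖ ^ 2 + r ^ 3 * ‖v‖ ^ 2 : ℝ) : ℂ) := by
      convert hq using 1
      push_cast
      ring
    exact_mod_cast this
  have : r * ‖WithLp.toLp 2 y‖ ^ 2 ≤ r * (r * ‖v‖) ^ 2 := by nlinarith
  exact le_of_sq_le_sq (le_of_mul_le_mul_left this hr) (by positivity)

end Matrix

/-! ### Amplifications and compressions of maps -/

section Amplify

variable {V : Type*} [AddCommGroup V] [Module ℂ V]
variable {ι κ μ : Type*} [Fintype ι] [Fintype κ]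

/-- The map `v ↦ c φ(v) d`. -/
def mulMap (c : Matrix κ ι ℂ) (φ : V →ₗ[ℂ] Matrix ι ι ℂ) (d : Matrix ι κ ℂ) :
    V →ₗ[ℂ] Matrix κ κ ℂ where
  toFun v := c * φ v * d
  map_add' v w := by rw [map_add, Matrix.mul_add, Matrix.add_mul]
  map_smul' r v := by rw [map_smul, Matrix.mul_smul, Matrix.smul_mul]; rfl

omit [Fintype κ] in
lemma amplify_mulMap (c : Matrix κ ι ℂ) (φ : V →ₗ[ℂ] Matrix ι ι ℂ) (d : Matrix ι κ ℂ) {k : ℕ}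
    (A : Matrix (Fin k) (Fin k) V) :
    amplify (mulMap c φ d) A = ((1 : Matrix (Fin k) (Fin k) ℂ) ⊗ₖ c) * amplify φ A *
      ((1 : Matrix (Fin k) (Fin k) ℂ) ⊗ₖ d) := by
  ext ⟨p, i⟩ ⟨q, j⟩
  simp [amplify, mulMap, Matrix.mul_apply, Fintype.sum_prod_type, Matrix.one_apply]

omit [Fintype ι] in
lemma amplify_add (φ ψ : V →ₗ[ℂ] Matrix ι ι ℂ) {k : ℕ} (A : Matrix (Fin k) (Fin k) V) :
    amplify (φ + ψ) A = amplify φ A + amplify ψ A := rfl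

omit [Fintype ι] in
lemma amplify_smul (c : ℂ) (φ : V →ₗ[ℂ] Matrix ι ι ℂ) {k : ℕ} (A : Matrix (Fin k) (Fin k) V) :
    amplify (c • φ) A = c • amplify φ A := rfl

open scoped Matrix.Norms.L2Operator in
lemma norm_kronecker_one_left [DecidableEq ι] [DecidableEq κ] (k : ℕ) {b : Matrix ι κ ℂ} {r : ℝ}
    (hr : 0 ≤ r) (hb : bᴴ * b = (r : ℂ) • (1 : Matrix κ κ ℂ)) :
    ‖(1 : Matrix (Fin k) (Fin k) ℂ) ⊗ₖ b‖ ^ 2 ≤ r := by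
  rw [sq, ← Matrix.l2_opNorm_conjTranspose_mul_self, Matrix.conjTranspose_kronecker,
    ← Matrix.mul_kronecker_mul, hb, Matrix.conjTranspose_one, Matrix.mul_one,
    Matrix.kronecker_smul, Matrix.one_kronecker_one, norm_smul, Complex.norm_real,
    Real.norm_of_nonneg hr]
  exact mul_le_of_le_one_right hr Matrix.l2_opNorm_one_le

end Amplify

lemma sum_comm_interleave {ι κ : Type*} [Fintype ι] [Fintype κ] (f : κ → ι → κ → ι → ℂ) :
    ∑ p, ∑ i, ∑ q, ∑ j, f p i q j = ∑ i, ∑ j, ∑ p, ∑ q, f p i q j := by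
  rw [Finset.sum_comm]
  refine Finset.sum_congr rfl fun i _ => ?_
  rw [Finset.sum_comm' (t' := Finset.univ) (s' := fun _ => Finset.univ) (by simp)]
  rw [Finset.sum_comm]
  simp_rw [Finset.sum_comm (s := (Finset.univ : Finset ι))]

/-! ### Completely positive maps, and cones containing the negative of the unit -/

namespace LocalOperatorSystem

variable {Γ V : Type*} [AddCommGroup V] [Module ℂ V] [StarAddMonoid V] [StarModule ℂ V]
variable {𝒮 : LocalOperatorSystem Γ V} {α : Γ}
variable {ι κ : Type*} [Fintype ι] [Fintype κ] [DecidableEq ι] [DecidableEq κ]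

/-- `φ : V → M_ι` is completely positive with respect to the cones `C_α`. -/
def IsCP (𝒮 : LocalOperatorSystem Γ V) (α : Γ) (φ : V →ₗ[ℂ] Matrix ι ι ℂ) : Prop :=
  ∀ k, ∀ A ∈ 𝒮.cone α k, (amplify φ A).PosSemidef

omit [Fintype ι] [DecidableEq ι] in
lemma IsCP.add {φ ψ : V →ₗ[ℂ] Matrix ι ι ℂ} (hφ : 𝒮.IsCP α φ) (hψ : 𝒮.IsCP α ψ) :
    𝒮.IsCP α (φ + ψ) := fun k A hA => by
  rw [amplify_add]; exact (hφ k A hA).add (hψ k A hA)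

omit [DecidableEq ι] [DecidableEq κ] in
lemma IsCP.mulMap {φ : V →ₗ[ℂ] Matrix ι ι ℂ} (hφ : 𝒮.IsCP α φ) (c : Matrix ι κ ℂ) :
    𝒮.IsCP α (mulMap cᴴ φ c) := fun k A hA => by
  have := (hφ k A hA).conjTranspose_mul_mul_same ((1 : Matrix (Fin k) (Fin k) ℂ) ⊗ₖ c)
  rwa [Matrix.conjTranspose_kronecker, Matrix.conjTranspose_one, ← amplify_mulMap] at this

omit [Fintype ι] [DecidableEq ι] in
lemma IsCP.map_unit_posSemidef {φ : V →ₗ[ℂ] Matrix ι ι ℂ} (hφ : 𝒮.IsCP α φ) :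
    (φ 𝒮.unit).PosSemidef := by
  have h := hφ 1 _ (mem_coneOn_fin.1 (scalarTensor_one_mem (𝒮 := 𝒮) (α := α) (ι := Fin 1)))
  convert h.submatrix (fun i : ι => ((0 : Fin 1), i)) using 1
  ext i j
  simp [amplify, scalarTensor]

/-- The map `v ↦ φ(v)_{i₀ i₀} 1`. -/
def entryMap (φ : V →ₗ[ℂ] Matrix ι ι ℂ) (i₀ : ι) : V →ₗ[ℂ] Matrix ι ι ℂ :=
  (LinearMap.toSpanSingleton ℂ (Matrix ι ι ℂ) 1) ∘ₗ Matrix.entryLinearMap ℂ ℂ i₀ i₀ ∘ₗ φ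

lemma IsCP.entryMap {φ : V →ₗ[ℂ] Matrix ι ι ℂ} (hφ : 𝒮.IsCP α φ) (i₀ : ι) {ε : ℝ} (hε : 0 ≤ ε) :
    𝒮.IsCP α ((ε : ℂ) • entryMap φ i₀) := fun k A hA => by
  have h := ((hφ k A hA).submatrix (fun p => (p, i₀))).kronecker
    (Matrix.PosSemidef.one (n := ι) (R := ℂ))
  have e : amplify (LocalOperatorSystem.entryMap φ i₀) A =
      (amplify φ A).submatrix (fun p => (p, i₀)) (fun p => (p, i₀)) ⊗ₖ (1 : Matrix ι ι ℂ) := by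
    ext ⟨p, i⟩ ⟨q, j⟩
    simp [amplify, LocalOperatorSystem.entryMap]
  rw [amplify_smul, e]
  exact h.smul (by exact_mod_cast hε)

/-- The map `V → M_ι` associated with a linear functional on `M_ι(V)`. -/
def mapOfFunctional (F : Matrix ι ι V →ₗ[ℂ] ℂ) : V →ₗ[ℂ] Matrix ι ι ℂ where
  toFun v := Matrix.of fun i j => F (Matrix.single i j v)
  map_add' v w := by ext i j; simp [Matrix.single_add]
  map_smul' c v := by ext i j; simp [← Matrix.smul_single]

/-- A vector `x` in `ℂᵏ ⊗ ℂ^ι` is a `k × ι` matrix `X`, and the quadratic form of the amplification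
at `x` is `F (X^* A X)`. -/
lemma isCP_mapOfFunctional (F : Matrix ι ι V →ₗ[ℂ] ℂ) (hF : ∀ A ∈ 𝒮.coneOn α ι, 0 ≤ F A) :
    𝒮.IsCP α (mapOfFunctional F) := fun k A hA => by
  refine Matrix.posSemidef_of_forall_nonneg fun x => ?_
  let X : Matrix (Fin k) ι ℂ := fun p i => x (p, i)
  have h := hF _ (rectSandwich_mem (mem_coneOn_fin.2 hA) X)
  convert h using 1
  rw [Matrix.matrix_eq_sum_single (rectSandwich Xᴴ A X)]
  have e : ∀ i j, F (Matrix.single i j (rectSandwich Xᴴ A X i j)) =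
      ∑ p, ∑ q, (Xᴴ i p * X q j) * mapOfFunctional F (A p q) i j := fun i j => by
    change mapOfFunctional F (rectSandwich Xᴴ A X i j) i j = _
    simp only [rectSandwich, map_sum, map_smul, Matrix.sum_apply, Matrix.smul_apply, smul_eq_mul]
  simp only [map_sum, e]
  simp only [dotProduct, Matrix.mulVec, Fintype.sum_prod_type, Finset.mul_sum]
  rw [sum_comm_interleave]
  refine Finset.sum_congr rfl fun i _ => Finset.sum_congr rfl fun j _ =>
    Finset.sum_congr rfl fun p _ => Finset.sum_congr rfl fun q _ => ?_
  have hX : Xᴴ i p = star (x (p, i)) := rfl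
  simp [hX, X, amplify]
  ring

/-- A single cone need not be proper. If it contains `-e`, it contains `-r e` at every level, and
adding this to a norm bound `r` lowers the bound to `0`. -/
lemma seminorm_eq_zero_of_neg_unit_mem
    (h : -scalarTensor (1 : Matrix (Fin 1) (Fin 1) ℂ) 𝒮.unit ∈ 𝒮.coneOn α (Fin 1)) {n : ℕ}
    (A : Matrix (Fin n) (Fin n) V) : 𝒮.seminorm α n A = 0 := by
  refine le_antisymm (seminorm_le le_rfl ?_) (𝒮.seminorm_nonneg α n A)
  have h1 : ∀ s : Finset (Fin n ⊕ Fin n), scalarTensor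
      (-∑ i ∈ s, Matrix.single i i (1 : ℂ)) 𝒮.unit ∈ 𝒮.coneOn α (Fin n ⊕ Fin n) := fun s => by
    induction s using Finset.induction_on with
    | empty =>
      have e : scalarTensor (-∑ i ∈ (∅ : Finset (Fin n ⊕ Fin n)), Matrix.single i i (1 : ℂ))
          𝒮.unit = 0 := by ext; simp [scalarTensor]
      rw [e]
      exact zero_mem _
    | insert i s hi ih =>
      rw [Finset.sum_insert hi, neg_add, scalarTensor_add]
      refine add_mem ?_ ih
      convert rectSandwich_mem h (Matrix.single 0 i (1 : ℂ)) using 1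
      rw [rectSandwich_neg, rectSandwich_scalarTensor]
      ext x y
      simp [scalarTensor]
  have h2 := h1 Finset.univ
  rw [Matrix.sum_single_one] at h2
  obtain ⟨r, hr, hA⟩ := exists_isNormBound 𝒮 α A
  have h3 := add_mem hA (smul_mem_coneOn h2 hr)
  unfold IsNormBound
  convert h3 using 1
  ext (i | i) (j | j) <;> by_cases hij : i = j <;> simp [scalarTensor, hij]

-- A vector with `x^* P x < 0` would compress `P ⊗ e` to a negative multiple of `e`.
omit [DecidableEq ι] in
lemma posSemidef_of_scalarTensor_mem
    (hu : -scalarTensor (1 : Matrix (Fin 1) (Fin 1) ℂ) 𝒮.unit ∉ 𝒮.coneOn α (Fin 1))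
    {P : Matrix ι ι ℂ} (hP : P.IsHermitian) (h : scalarTensor P 𝒮.unit ∈ 𝒮.coneOn α ι) :
    P.PosSemidef := by
  refine Matrix.PosSemidef.of_dotProduct_mulVec_nonneg hP fun x => ?_
  by_contra hx
  let X : Matrix ι (Fin 1) ℂ := fun i _ => x i
  obtain ⟨c, hc⟩ : ∃ c : ℝ, star x ⬝ᵥ P *ᵥ x = c := by
    have h1 : star (star x ⬝ᵥ P *ᵥ x) = star x ⬝ᵥ P *ᵥ x := by
      rw [← Matrix.star_dotProduct, Matrix.star_mulVec, hP.eq, Matrix.dotProduct_mulVec]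
    exact (Complex.conj_eq_iff_real.1 h1)
  have hc0 : c < 0 := by
    rw [hc] at hx
    by_contra hc'
    exact hx (by exact_mod_cast not_lt.1 hc')
  have h1 := rectSandwich_mem h X
  rw [rectSandwich_scalarTensor] at h1
  have h2 : Xᴴ * P * X = (c : ℂ) • (1 : Matrix (Fin 1) (Fin 1) ℂ) := by
    ext i j
    rw [Subsingleton.elim i 0, Subsingleton.elim j 0, Matrix.smul_apply, Matrix.one_apply_eq,
      smul_eq_mul, mul_one, ← hc, Matrix.mul_assoc, Matrix.mul_apply]
    rfl
  have h3 := smul_mem_coneOn h1 (r := -c⁻¹) (by simpa using hc0.le)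
  apply hu
  convert h3 using 1
  rw [h2]
  ext i j
  have : (c : ℂ) ≠ 0 := by exact_mod_cast hc0.ne
  simp [scalarTensor, smul_smul, this]

end LocalOperatorSystem

/-! ### Complete contractions as corners of completely positive maps -/

namespace LocalOperatorSystem

variable {Γ V : Type*} [AddCommGroup V] [Module ℂ V] [StarAddMonoid V] [StarModule ℂ V]
variable {𝒮 : LocalOperatorSystem Γ V} {α : Γ}
variable {ι κ : Type*} [Fintype ι] [Fintype κ] [DecidableEq ι] [DecidableEq κ]

/-- Write `P = X^* X`, `Q = Y^* Y`. Then `y = X^{-*} x Y⁻¹` has norm at most `1`, and so does the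
amplified `φ(y)`. With `X`, `Y` viewed as vectors, the traces are their squared norms and the double
sum is `⟨X, φ(y) Y⟩`, so `re_star_dotProduct_mulVec_bound` applies. -/
lemma trace_sum_nonneg_of_posDef {φ : V →ₗ[ℂ] Matrix ι ι ℂ}
    (hφ : IsCompleteBound 𝒮.seminorm α φ 1) {P Q : Matrix ι ι ℂ} (hP : P.PosDef) (hQ : Q.PosDef)
    {x : Matrix ι ι V}
    (h : Matrix.fromBlocks (scalarTensor P 𝒮.unit) x xᴴ (scalarTensor Q 𝒮.unit) ∈
      𝒮.coneOn α (ι ⊕ ι)) :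
    0 ≤ (P.trace + Q.trace + 2 * ∑ i, ∑ j, φ (x i j) i j).re := by
  obtain ⟨X, hX⟩ := hP.posSemidef.exists_eq_conjTranspose_mul_self
  obtain ⟨Y, hY⟩ := hQ.posSemidef.exists_eq_conjTranspose_mul_self
  have unit_of : ∀ {P X : Matrix ι ι ℂ}, P.PosDef → P = Xᴴ * X → IsUnit X.det := by
    intro P X hP hX
    have := (Matrix.isUnit_iff_isUnit_det _).1 hP.isUnit
    rw [hX, Matrix.det_mul] at this
    exact isUnit_of_mul_isUnit_right this
  have hXu := unit_of hP hX
  have hYu := unit_of hQ hY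
  have hXX : X * X⁻¹ = 1 := Matrix.mul_nonsing_inv X hXu
  have hYY : Y * Y⁻¹ = 1 := Matrix.mul_nonsing_inv Y hYu
  have hXX' : X⁻¹ * X = 1 := Matrix.nonsing_inv_mul X hXu
  have hYY' : Y⁻¹ * Y = 1 := Matrix.nonsing_inv_mul Y hYu
  have inv_conj : ∀ {X : Matrix ι ι ℂ}, X * X⁻¹ = 1 → (X⁻¹)ᴴ * (Xᴴ * X) * X⁻¹ = 1 := by
    intro X h
    rw [← Matrix.mul_assoc, ← Matrix.conjTranspose_mul, Matrix.mul_assoc, h,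
      Matrix.conjTranspose_one, Matrix.one_mul]
  set y := rectSandwich (X⁻¹)ᴴ x Y⁻¹ with hy
  have hyb : 𝒮.IsNormBound α y 1 := by
    have h1 := fromBlocks_congr_mem h X⁻¹ Y⁻¹
    have h2 : rectSandwich (Y⁻¹)ᴴ xᴴ X⁻¹ = yᴴ := by
      rw [hy, conjTranspose_rectSandwich, Matrix.conjTranspose_conjTranspose]
    rw [rectSandwich_scalarTensor, rectSandwich_scalarTensor, hX, hY, inv_conj hXX, inv_conj hYY,
      h2] at h1
    simpa [IsNormBound] using h1
  have hxy : x = rectSandwich Xᴴ y Y := by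
    rw [hy, rectSandwich_rectSandwich, ← Matrix.conjTranspose_mul, hXX', hYY',
      Matrix.conjTranspose_one, rectSandwich_one]
  let e := Fintype.equivFin ι
  have hb := hφ _ (y.submatrix e.symm e.symm)
  have hs := seminorm_le zero_le_one (hyb.submatrix e.symm.injective)
  have hn := hb.trans ((one_mul _).trans_le hs)
  have h3 := Matrix.re_star_dotProduct_mulVec_bound hn (fun z : Fin _ × ι => X (e.symm z.1) z.2)
    (fun z : Fin _ × ι => Y (e.symm z.1) z.2)
  have tr : ∀ X : Matrix ι ι ℂ, ((Xᴴ * X).trace).re =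
      ∑ z : Fin (Fintype.card ι) × ι, ‖X (e.symm z.1) z.2‖ ^ 2 := by
    intro X
    rw [Fintype.sum_prod_type, Finset.sum_comm, Matrix.trace, Complex.re_sum]
    refine Finset.sum_congr rfl fun i _ => ?_
    rw [Equiv.sum_comp e.symm (fun p => ‖X p i‖ ^ 2), Matrix.diag_apply, Matrix.mul_apply,
      Complex.re_sum]
    refine Finset.sum_congr rfl fun p _ => ?_
    rw [Matrix.conjTranspose_apply, Complex.star_def, Complex.conj_mul']
    norm_cast
  have hsum : ∑ i, ∑ j, φ (x i j) i j =
      star (fun z : Fin (Fintype.card ι) × ι => X (e.symm z.1) z.2) ⬝ᵥ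
        amplify φ (y.submatrix e.symm e.symm) *ᵥ
          (fun z : Fin (Fintype.card ι) × ι => Y (e.symm z.1) z.2) := by
    have h4 : ∀ i j, φ (x i j) i j = ∑ p, ∑ q,
        Xᴴ i (e.symm p) * Y (e.symm q) j * φ (y (e.symm p) (e.symm q)) i j := fun i j => by
      rw [hxy]
      simp only [rectSandwich, map_sum, map_smul, Matrix.sum_apply, Matrix.smul_apply, smul_eq_mul]
      rw [← Equiv.sum_comp e.symm]
      exact Finset.sum_congr rfl fun p _ => (Equiv.sum_comp e.symm _).symm
    simp only [h4, dotProduct, Matrix.mulVec, Fintype.sum_prod_type, Finset.mul_sum]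
    rw [sum_comm_interleave]
    refine Finset.sum_congr rfl fun i _ => Finset.sum_congr rfl fun j _ =>
      Finset.sum_congr rfl fun p _ => Finset.sum_congr rfl fun q _ => ?_
    simp [amplify]
    ring
  rw [Complex.add_re, Complex.add_re, hX, hY, tr, tr, hsum,
    show ∀ z : ℂ, (2 * z).re = 2 * z.re by simp]
  exact h3

/-- Since `-e` is not positive, `P` and `Q` are positive semidefinite; add `ε` to make them definite
and let `ε → 0`. -/
lemma trace_sum_nonneg {φ : V →ₗ[ℂ] Matrix ι ι ℂ}
    (hu : -scalarTensor (1 : Matrix (Fin 1) (Fin 1) ℂ) 𝒮.unit ∉ 𝒮.coneOn α (Fin 1))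
    (hφ : IsCompleteBound 𝒮.seminorm α φ 1) {P Q : Matrix ι ι ℂ} (hP : P.IsHermitian)
    (hQ : Q.IsHermitian) {x : Matrix ι ι V}
    (h : Matrix.fromBlocks (scalarTensor P 𝒮.unit) x xᴴ (scalarTensor Q 𝒮.unit) ∈
      𝒮.coneOn α (ι ⊕ ι)) :
    0 ≤ (P.trace + Q.trace + 2 * ∑ i, ∑ j, φ (x i j) i j).re := by
  have hP' : P.PosSemidef := posSemidef_of_scalarTensor_mem hu hP (submatrix_mem h Sum.inl)
  have hQ' : Q.PosSemidef := posSemidef_of_scalarTensor_mem hu hQ (submatrix_mem h Sum.inr)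
  have key : ∀ ε : ℝ, 0 < ε → 0 ≤ (P.trace + Q.trace + 2 * ∑ i, ∑ j, φ (x i j) i j).re +
      ε * (2 * Fintype.card ι) := fun ε hε => by
    have h1 : ((ε : ℂ) • (1 : Matrix ι ι ℂ)).PosDef :=
      Matrix.PosDef.one.smul (by exact_mod_cast hε)
    have h2 := trace_sum_nonneg_of_posDef hφ (h1.posSemidef_add hP') (h1.posSemidef_add hQ')
      (x := x) (by
        convert add_mem h (smul_mem_coneOn
          (scalarTensor_one_mem (𝒮 := 𝒮) (α := α) (ι := ι ⊕ ι)) hε.le) using 1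
        ext (i | i) (j | j) <;> by_cases hij : i = j <;> simp [scalarTensor, hij, add_smul])
    convert h2 using 1
    simp [Matrix.trace_add, Matrix.trace_smul]
    ring
  have hc : Filter.Tendsto (fun ε : ℝ => (P.trace + Q.trace + 2 * ∑ i, ∑ j, φ (x i j) i j).re +
      ε * (2 * Fintype.card ι)) (nhdsWithin 0 (Set.Ioi 0))
      (nhds ((P.trace + Q.trace + 2 * ∑ i, ∑ j, φ (x i j) i j).re + 0 * (2 * Fintype.card ι))) :=
    (Continuous.tendsto (by fun_prop) 0).mono_left nhdsWithin_le_nhds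
  simp only [zero_mul, add_zero] at hc
  exact ge_of_tendsto hc (eventually_nhdsWithin_of_forall key)

/-- The matrices `A` over `V` with `A + A^*` positive. -/
def realPartCone (𝒮 : LocalOperatorSystem Γ V) (α : Γ) (ι : Type*) [Fintype ι] :
    PointedCone ℝ (Matrix ι ι V) where
  carrier := {A | A + Aᴴ ∈ 𝒮.coneOn α ι}
  add_mem' {A B} hA hB := by
    have : A + B + (A + B)ᴴ = (A + Aᴴ) + (B + Bᴴ) := by
      rw [Matrix.conjTranspose_add]; abel
    rw [Set.mem_ofPred_eq, this]
    exact add_mem hA hB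
  zero_mem' := by simp
  smul_mem' c A hA := by
    have : c • A + (c • A)ᴴ = c • (A + Aᴴ) := by
      have h1 : (c • A)ᴴ = c • Aᴴ := by
        ext i j
        change star (((c : ℝ) : ℂ) • A j i) = ((c : ℝ) : ℂ) • star (A j i)
        rw [star_smul, Complex.star_def, Complex.conj_ofReal]
      rw [h1, smul_add]
    rw [Set.mem_ofPred_eq, this]
    exact Submodule.smul_mem _ c hA

-- For `A` positive, `±i A` is skew-adjoint and so lies in the real-part cone, which forces `F A` to
-- be real.
omit [DecidableEq ι] in
lemma nonneg_of_re_nonneg_on_realPartCone {F : Matrix ι ι V →ₗ[ℂ] ℂ}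
    (hF : ∀ A ∈ 𝒮.realPartCone α ι, 0 ≤ (F A).re) {A : Matrix ι ι V} (hA : A ∈ 𝒮.coneOn α ι) :
    0 ≤ F A := by
  have hH : Aᴴ = A := isHermitian_of_mem_coneOn hA
  have h1 : 0 ≤ (F A).re := hF A (by
    change A + Aᴴ ∈ 𝒮.coneOn α ι
    rw [hH]; exact add_mem hA hA)
  have h2 : ∀ c : ℂ, star c = -c → 0 ≤ (F (c • A)).re := fun c hc => hF _ (by
    change c • A + (c • A)ᴴ ∈ 𝒮.coneOn α ι
    rw [Matrix.conjTranspose_smul, hH, hc, neg_smul, add_neg_cancel]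
    exact zero_mem _)
  have h3 := h2 Complex.I (by simp)
  have h4 := h2 (-Complex.I) (by simp)
  rw [map_smul] at h3 h4
  simp at h3 h4
  exact Complex.nonneg_iff.2 ⟨h1, (le_antisymm h4 h3).symm ▸ rfl⟩

/-- A complete contraction into `M_ι` is the off-diagonal corner of a completely positive map into
`M_{ι ⊕ ι}` whose diagonal corners are unital. -/
theorem exists_isCP_corner {φ : V →ₗ[ℂ] Matrix ι ι ℂ}
    (hu : -scalarTensor (1 : Matrix (Fin 1) (Fin 1) ℂ) 𝒮.unit ∉ 𝒮.coneOn α (Fin 1))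
    (hφ : IsCompleteBound 𝒮.seminorm α φ 1) :
    ∃ θ : V →ₗ[ℂ] Matrix (ι ⊕ ι) (ι ⊕ ι) ℂ, 𝒮.IsCP α θ ∧
      (∀ v, (θ v).toBlocks₁₂ = φ v) ∧ (θ 𝒮.unit).toBlocks₁₁ = 1 ∧
      (θ 𝒮.unit).toBlocks₂₂ = 1 := by
  -- The lower-left block is `0` to keep `j` complex linear; the real-part cone supplies `x^*` by
  -- symmetrising.
  let j : Matrix ι ι ℂ × Matrix ι ι ℂ × Matrix ι ι V →ₗ[ℂ] Matrix (ι ⊕ ι) (ι ⊕ ι) V :=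
    { toFun := fun w => Matrix.fromBlocks (scalarTensor w.1 𝒮.unit) w.2.2 0
        (scalarTensor w.2.1 𝒮.unit)
      map_add' := fun w w' => by
        ext (i | i) (j | j) <;> simp [scalarTensor, add_smul]
      map_smul' := fun c w => by
        ext (i | i) (j | j) <;> simp [scalarTensor, smul_smul] }
  let G : Matrix ι ι ℂ × Matrix ι ι ℂ × Matrix ι ι V →ₗ[ℂ] ℂ :=
    { toFun := fun w => w.1.trace + w.2.1.trace + ∑ i, ∑ j, φ (w.2.2 i j) i j
      map_add' := fun w w' => by
        simp [Matrix.trace_add, Finset.sum_add_distrib]; ring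
      map_smul' := fun c w => by
        simp [Matrix.trace_smul, Finset.mul_sum, mul_add] }
  obtain ⟨F, hFj, hF⟩ := exists_complex_extension_nonneg (𝒮.realPartCone α (ι ⊕ ι)) j G
    (by
      rintro ⟨a, b, x⟩ hw
      have e : j (a, b, x) + (j (a, b, x))ᴴ = Matrix.fromBlocks (scalarTensor (a + aᴴ) 𝒮.unit) x xᴴ
          (scalarTensor (b + bᴴ) 𝒮.unit) := by
        simp only [j, LinearMap.coe_mk, AddHom.coe_mk, Matrix.fromBlocks_conjTranspose,
          Matrix.fromBlocks_add, conjTranspose_scalarTensor _ 𝒮.unit_isSelfAdjoint,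
          scalarTensor_add, Matrix.conjTranspose_zero, add_zero, zero_add]
      have h1 := trace_sum_nonneg hu hφ (Matrix.isHermitian_add_transpose_self a)
        (Matrix.isHermitian_add_transpose_self b) (x := x) (e ▸ hw)
      simp only [G, LinearMap.coe_mk, AddHom.coe_mk]
      simp [Matrix.trace_add, Matrix.trace_conjTranspose] at h1 ⊢
      linarith)
    (by
      intro y
      obtain ⟨r, hr, h⟩ := exists_unit_sub_mem (𝒮 := 𝒮) (α := α) (-(y + yᴴ))
        (Matrix.isHermitian_add_transpose_self y).neg
      -- Half of `r`, because adding the adjoint doubles the diagonal.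
      refine ⟨(((r / 2 : ℝ) : ℂ) • 1, ((r / 2 : ℝ) : ℂ) • 1, 0), ?_⟩
      have e : j (((r / 2 : ℝ) : ℂ) • 1, ((r / 2 : ℝ) : ℂ) • 1, 0) =
          scalarTensor (((r / 2 : ℝ) : ℂ) • 1) 𝒮.unit := by
        ext (i | i) (k | k) <;> by_cases hij : i = k <;> simp [j, scalarTensor, hij]
      change _ + (_ : Matrix (ι ⊕ ι) (ι ⊕ ι) V)ᴴ ∈ 𝒮.coneOn α (ι ⊕ ι)
      convert h using 1
      rw [e, Matrix.conjTranspose_add, conjTranspose_scalarTensor _ 𝒮.unit_isSelfAdjoint,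
        sub_neg_eq_add, Matrix.conjTranspose_smul, Matrix.conjTranspose_one, Complex.star_def,
        Complex.conj_ofReal, add_add_add_comm, ← scalarTensor_add, ← add_smul]
      congr 4
      push_cast
      ring)
  refine ⟨mapOfFunctional F,
    isCP_mapOfFunctional F fun A hA => nonneg_of_re_nonneg_on_realPartCone hF hA,
    fun v => ?_, ?_, ?_⟩
  · ext k l
    have e : Matrix.single (Sum.inl k) (Sum.inr l) v = j (0, 0, Matrix.single k l v) := by
      ext (i | i) (i' | i') <;> simp [j, scalarTensor, Matrix.single_apply]
    change F (Matrix.single (Sum.inl k) (Sum.inr l) v) = _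
    rw [e, hFj]
    simp only [G, LinearMap.coe_mk, AddHom.coe_mk]
    rw [Finset.sum_eq_single k, Finset.sum_eq_single l]
    · simp
    · intro i _ hi
      simp [hi.symm]
    · simp
    · intro i _ hi
      simp [hi.symm]
    · simp
  · ext k l
    have e : Matrix.single (Sum.inl k) (Sum.inl l) 𝒮.unit = j (Matrix.single k l 1, 0, 0) := by
      ext (i | i) (i' | i') <;> simp [j, scalarTensor, Matrix.single_apply]
    change F (Matrix.single (Sum.inl k) (Sum.inl l) 𝒮.unit) = _
    rw [e, hFj]
    by_cases hkl : k = l <;> simp [G, hkl, Matrix.one_apply]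
  · ext k l
    have e : Matrix.single (Sum.inr k) (Sum.inr l) 𝒮.unit = j (0, Matrix.single k l 1, 0) := by
      ext (i | i) (i' | i') <;> simp [j, scalarTensor, Matrix.single_apply]
    change F (Matrix.single (Sum.inr k) (Sum.inr l) 𝒮.unit) = _
    rw [e, hFj]
    by_cases hkl : k = l <;> simp [G, hkl, Matrix.one_apply]

end LocalOperatorSystem

/-! ### Complete contractions as compressions of unital completely positive maps -/

namespace LocalOperatorSystem

variable {Γ V : Type*} [AddCommGroup V] [Module ℂ V] [StarAddMonoid V] [StarModule ℂ V]
variable {𝒮 : LocalOperatorSystem Γ V} {α : Γ}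
variable {ι κ : Type*} [Fintype ι] [Fintype κ] [DecidableEq ι] [DecidableEq κ]

open scoped Matrix.Norms.L2Operator in
omit [StarAddMonoid V] [StarModule ℂ V] in
lemma _root_.IsCompleteBound.eq_zero {p : Γ → (n : ℕ) → Matrix (Fin n) (Fin n) V → ℝ}
    {φ : V →ₗ[ℂ] Matrix ι ι ℂ} {K : ℝ} (h : IsCompleteBound p α φ K)
    (hp : ∀ (n : ℕ) (A : Matrix (Fin n) (Fin n) V), p α n A = 0) : φ = 0 := by
  ext v i j
  have h1 := h 1 (Matrix.of fun _ _ => v)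
  rw [hp, mul_zero] at h1
  have h2 := norm_le_zero_iff.1 h1
  exact congrFun (congrFun h2 (0, i)) (0, j)

-- Applied to the block matrix of `A`, the amplification keeps the diagonal scalar because the map
-- is unital; its off-diagonal corner is then bounded by `r`.
open scoped Matrix.Norms.L2Operator in
lemma IsLUCP.isCompleteBound {φ : V →ₗ[ℂ] Matrix ι ι ℂ} (hφ : 𝒮.IsLUCP α φ) :
    IsCompleteBound 𝒮.seminorm α φ 1 := fun k A => by
  rw [one_mul]
  refine le_of_forall_gt_imp_ge_of_dense fun r hr => ?_
  have hr0 : 0 < r := (𝒮.seminorm_nonneg α k A).trans_lt hr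
  have h1 := hφ.posSemidef _ _ (isNormBound_iff.2 ((𝒮.isNormBound_seminorm α A).mono hr.le))
  have h2 := h1.submatrix (fun z : (Fin k × ι) ⊕ (Fin k × ι) =>
    (finSumFinEquiv (Sum.map Prod.fst Prod.fst z), Sum.elim Prod.snd Prod.snd z))
  refine Matrix.PosSemidef.norm_offDiagonal_le (Z := amplify φ Aᴴ) hr0 ?_
  convert h2 using 1
  ext (⟨p, i⟩ | ⟨p, i⟩) (⟨q, j⟩ | ⟨q, j⟩) <;>
    simp only [amplify, Matrix.submatrix_apply, Matrix.comp_apply, Matrix.map_apply, Sum.map_inl,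
      Sum.map_inr, Sum.elim_inl, Sum.elim_inr, blockMatrix_apply, Matrix.fromBlocks_apply₁₁,
      Matrix.fromBlocks_apply₁₂, Matrix.fromBlocks_apply₂₁, Matrix.fromBlocks_apply₂₂] <;>
    by_cases hpq : p = q <;> by_cases hij : i = j <;>
    simp [scaledUnit, hpq, hij, hφ.map_unit]

/-- Up to `ε`, a complete contraction into `M_ι` is a compression of a local unital completely
positive map. -/
theorem exists_isLUCP_mulMap {φ : V →ₗ[ℂ] Matrix ι ι ℂ} (hφ0 : φ ≠ 0)
    (hφ : IsCompleteBound 𝒮.seminorm α φ 1) {ε : ℝ} (hε : 0 < ε) :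
    ∃ (N : ℕ) (θ : V →ₗ[ℂ] Matrix (Fin N) (Fin N) ℂ) (a : Matrix ι (Fin N) ℂ)
      (b : Matrix (Fin N) ι ℂ), 𝒮.IsLUCP α θ ∧ φ = mulMap a θ b ∧
      a * aᴴ = ((1 + ε : ℝ) : ℂ) • (1 : Matrix ι ι ℂ) ∧
      bᴴ * b = ((1 + ε : ℝ) : ℂ) • (1 : Matrix ι ι ℂ) := by
  have hu : -scalarTensor (1 : Matrix (Fin 1) (Fin 1) ℂ) 𝒮.unit ∉ 𝒮.coneOn α (Fin 1) :=
    fun h => hφ0 (IsCompleteBound.eq_zero hφ fun _ => seminorm_eq_zero_of_neg_unit_mem h)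
  obtain ⟨i₀⟩ : Nonempty ι := by
    by_contra h
    rw [not_nonempty_iff] at h
    exact hφ0 (LinearMap.ext fun v => Subsingleton.elim _ _)
  obtain ⟨θ, hθ, h12, h11, h22⟩ := exists_isCP_corner hu hφ
  -- `θ e` may be singular. The added term is completely positive and a multiple of the identity, so
  -- it leaves the corner `φ` unchanged; as `θ e` has entry `1` at `i₀`, the value at `e` becomes `θ
  -- e + ε`.
  set θε := θ + (ε : ℂ) • entryMap θ (Sum.inl i₀) with hθε
  have hcp : 𝒮.IsCP α θε := hθ.add (hθ.entryMap _ hε.le)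
  have hi₀ : θ 𝒮.unit (Sum.inl i₀) (Sum.inl i₀) = 1 := by
    have := congrFun (congrFun h11 i₀) i₀
    rwa [Matrix.one_apply_eq] at this
  have hval : ∀ v, θε v = θ v + (ε : ℂ) • (θ v (Sum.inl i₀) (Sum.inl i₀)) • 1 := fun v => rfl
  have hunit : θε 𝒮.unit = θ 𝒮.unit + (ε : ℂ) • 1 := by rw [hval, hi₀, one_smul]
  have hpd : (θε 𝒮.unit).PosDef := by
    rw [hunit]
    exact (Matrix.PosDef.one.smul (by exact_mod_cast hε : (0 : ℂ) < ε)).posSemidef_add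
      hθ.map_unit_posSemidef
  obtain ⟨B, hB⟩ := hpd.posSemidef.exists_eq_conjTranspose_mul_self
  have hBu : IsUnit B.det := by
    have := (Matrix.isUnit_iff_isUnit_det _).1 hpd.isUnit
    rw [hB, Matrix.det_mul] at this
    exact isUnit_of_mul_isUnit_right this
  let e := Fintype.equivFin (ι ⊕ ι)
  set D : Matrix (Fin (Fintype.card (ι ⊕ ι))) (ι ⊕ ι) ℂ := B.submatrix e.symm id with hD
  set C : Matrix (ι ⊕ ι) (Fin (Fintype.card (ι ⊕ ι))) ℂ := B⁻¹.submatrix id e.symm with hC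
  have hCD : C * D = 1 := by
    rw [hC, hD, Matrix.submatrix_mul_equiv, Matrix.nonsing_inv_mul B hBu, Matrix.submatrix_id_id]
  have hDC : D * C = 1 := by
    have : D * C = (B * B⁻¹).submatrix e.symm e.symm := by ext; simp [hC, hD, Matrix.mul_apply]
    rw [this, Matrix.mul_nonsing_inv B hBu, Matrix.submatrix_one_equiv]
  have hDD : θε 𝒮.unit = Dᴴ * D := by
    rw [hB, hD, Matrix.conjTranspose_submatrix, Matrix.submatrix_mul_equiv, Matrix.submatrix_id_id]
  let R : Matrix ι (ι ⊕ ι) ℂ := Matrix.fromCols 1 0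
  let L : Matrix (ι ⊕ ι) ι ℂ := Matrix.fromRows 0 1
  have hcorner : ∀ M : Matrix (ι ⊕ ι) (ι ⊕ ι) ℂ, R * M * L = M.toBlocks₁₂ := fun M => by
    ext i j
    simp [R, L, Matrix.mul_apply, Matrix.one_apply, Matrix.toBlocks₁₂]
  have hR : ∀ M : Matrix (ι ⊕ ι) (ι ⊕ ι) ℂ, R * M * Rᴴ = M.toBlocks₁₁ := fun M => by
    ext i j
    simp [R, Matrix.mul_apply, Matrix.one_apply, Matrix.toBlocks₁₁, apply_ite]
  have hL : ∀ M : Matrix (ι ⊕ ι) (ι ⊕ ι) ℂ, Lᴴ * M * L = M.toBlocks₂₂ := fun M => by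
    ext i j
    simp [L, Matrix.mul_apply, Matrix.one_apply, Matrix.toBlocks₂₂, apply_ite]
  -- With `θε e = D^* D` and `C = D⁻¹`, the map `C^* θε C` is unital; `D` undoes the normalisation
  -- while `R` and `L` cut out the corner. Thus `a a^*` and `b^* b` are the diagonal blocks of `θε
  -- e`.
  refine ⟨Fintype.card (ι ⊕ ι), mulMap Cᴴ θε C, R * Dᴴ, D * L, ⟨?_, hcp.mulMap C⟩, ?_, ?_, ?_⟩
  · change Cᴴ * θε 𝒮.unit * C = 1
    rw [hDD, ← Matrix.mul_assoc, ← Matrix.conjTranspose_mul, Matrix.mul_assoc, hDC,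
      Matrix.conjTranspose_one, Matrix.one_mul]
  · ext1 v
    change φ v = R * Dᴴ * (Cᴴ * θε v * C) * (D * L)
    have : R * Dᴴ * (Cᴴ * θε v * C) * (D * L) = R * ((C * D)ᴴ * θε v * (C * D)) * L := by
      simp only [Matrix.conjTranspose_mul, Matrix.mul_assoc]
    rw [this, hCD, Matrix.conjTranspose_one, Matrix.one_mul, Matrix.mul_one, hcorner, ← h12, hval]
    ext i j
    simp [Matrix.toBlocks₁₂]
  · have : R * Dᴴ * (R * Dᴴ)ᴴ = R * (Dᴴ * D) * Rᴴ := by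
      simp only [Matrix.conjTranspose_mul, Matrix.conjTranspose_conjTranspose, Matrix.mul_assoc]
    rw [this, ← hDD, hR, hunit]
    have h : (θ 𝒮.unit + (ε : ℂ) • 1).toBlocks₁₁ =
        (θ 𝒮.unit).toBlocks₁₁ + (ε : ℂ) • (1 : Matrix ι ι ℂ) := by
      ext i j
      simp [Matrix.toBlocks₁₁, Matrix.one_apply]
    rw [h, h11]
    push_cast
    rw [add_smul, one_smul]
  · have : (D * L)ᴴ * (D * L) = Lᴴ * (Dᴴ * D) * L := by
      simp only [Matrix.conjTranspose_mul, Matrix.mul_assoc]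
    rw [this, ← hDD, hL, hunit]
    have h : (θ 𝒮.unit + (ε : ℂ) • 1).toBlocks₂₂ =
        (θ 𝒮.unit).toBlocks₂₂ + (ε : ℂ) • (1 : Matrix ι ι ℂ) := by
      ext i j
      simp [Matrix.toBlocks₂₂, Matrix.one_apply]
    rw [h, h22]
    push_cast
    rw [add_smul, one_smul]

end LocalOperatorSystem

/-! ### Tensor products of maps -/

section TensorMap

variable {V W : Type*} [AddCommGroup V] [Module ℂ V] [AddCommGroup W] [Module ℂ W]
variable {ι ι' κ κ' : Type*}

lemma tensorMap_mulMap [Fintype ι] [Fintype κ] [Fintype ι'] [Fintype κ'] (a : Matrix ι ι' ℂ)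
    (b : Matrix ι' ι ℂ) (c : Matrix κ κ' ℂ) (d : Matrix κ' κ ℂ) (φ : V →ₗ[ℂ] Matrix ι' ι' ℂ)
    (ψ : W →ₗ[ℂ] Matrix κ' κ' ℂ) :
    tensorMap (mulMap a φ b) (mulMap c ψ d) = mulMap (a ⊗ₖ c) (tensorMap φ ψ) (b ⊗ₖ d) := by
  refine TensorProduct.ext' fun v w => ?_
  change (a * φ v * b) ⊗ₖ (c * ψ w * d) = (a ⊗ₖ c) * (φ v ⊗ₖ ψ w) * (b ⊗ₖ d)
  rw [Matrix.mul_kronecker_mul, Matrix.mul_kronecker_mul]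

lemma tensorMap_smul_smul (c d : ℂ) (φ : V →ₗ[ℂ] Matrix ι ι ℂ) (ψ : W →ₗ[ℂ] Matrix κ κ ℂ) :
    tensorMap (c • φ) (d • ψ) = (c * d) • tensorMap φ ψ := by
  refine TensorProduct.ext' fun v w => ?_
  change (c • φ v) ⊗ₖ (d • ψ w) = (c * d) • (φ v ⊗ₖ ψ w)
  rw [Matrix.smul_kronecker, Matrix.kronecker_smul, smul_smul]

lemma tensorMap_zero_left (ψ : W →ₗ[ℂ] Matrix κ κ ℂ) :
    tensorMap (0 : V →ₗ[ℂ] Matrix ι ι ℂ) ψ = 0 := by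
  simpa using tensorMap_smul_smul 0 1 (0 : V →ₗ[ℂ] Matrix ι ι ℂ) ψ

lemma tensorMap_zero_right (φ : V →ₗ[ℂ] Matrix ι ι ℂ) :
    tensorMap φ (0 : W →ₗ[ℂ] Matrix κ κ ℂ) = 0 := by
  simpa using tensorMap_smul_smul 1 0 φ (0 : W →ₗ[ℂ] Matrix κ κ ℂ)

end TensorMap

/-! ### Complete bounds -/

section CompleteBounds

open scoped Matrix.Norms.L2Operator

variable {Γ V : Type*} [AddCommGroup V] [Module ℂ V] {ι : Type*} [Fintype ι] [DecidableEq ι]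
variable {p : Γ → (n : ℕ) → Matrix (Fin n) (Fin n) V → ℝ} {ρ : Γ} {φ : V →ₗ[ℂ] Matrix ι ι ℂ}

lemma IsCompleteBound.of_forall_gt {K : ℝ} (h : ∀ L, K < L → IsCompleteBound p ρ φ L) :
    IsCompleteBound p ρ φ K := fun k A => by
  have hc : Filter.Tendsto (fun L : ℝ => L * p ρ k A) (nhdsWithin K (Set.Ioi K))
      (nhds (K * p ρ k A)) := (Continuous.tendsto (by fun_prop) K).mono_left nhdsWithin_le_nhds
  exact ge_of_tendsto hc (eventually_nhdsWithin_of_forall fun L hL => h L hL k A)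

lemma IsCompleteBound.mono (hp : ∀ ρ n A, 0 ≤ p ρ n A) {K L : ℝ} (h : IsCompleteBound p ρ φ K)
    (hKL : K ≤ L) : IsCompleteBound p ρ φ L := fun k A =>
  (h k A).trans (mul_le_mul_of_nonneg_right hKL (hp ρ k A))

lemma IsCompleteBound.smul {K : ℝ} (h : IsCompleteBound p ρ φ K) (c : ℂ) :
    IsCompleteBound p ρ (c • φ) (‖c‖ * K) := fun k A => by
  rw [amplify_smul, norm_smul, mul_assoc]
  exact mul_le_mul_of_nonneg_left (h k A) (norm_nonneg c)

lemma isCompleteBound_zero (hp : ∀ ρ n A, 0 ≤ p ρ n A) {K : ℝ} (hK : 0 ≤ K) :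
    IsCompleteBound p ρ (0 : V →ₗ[ℂ] Matrix ι ι ℂ) K := fun k A => by
  have : amplify (0 : V →ₗ[ℂ] Matrix ι ι ℂ) A = 0 := rfl
  rw [this, norm_zero]
  exact mul_nonneg hK (hp ρ k A)

lemma IsLCB.isCompleteBound_lcbNorm (hp : ∀ ρ n A, 0 ≤ p ρ n A) (h : IsLCB p ρ φ) :
    IsCompleteBound p ρ φ (lcbNorm p ρ φ) := by
  refine IsCompleteBound.of_forall_gt fun L hL => ?_
  obtain ⟨K, hK, hφ⟩ := h
  unfold lcbNorm at hL
  obtain ⟨M, hM, hML⟩ := exists_lt_of_csInf_lt ⟨K, And.intro hK.le hφ⟩ hL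
  exact hM.2.mono hp hML.le

lemma lcbNorm_nonneg (p : Γ → (n : ℕ) → Matrix (Fin n) (Fin n) V → ℝ) (ρ : Γ)
    (φ : V →ₗ[ℂ] Matrix ι ι ℂ) : 0 ≤ lcbNorm p ρ φ :=
  Real.sInf_nonneg fun _ h => h.1

lemma lcbNorm_le {K : ℝ} (hK : 0 ≤ K) (h : IsCompleteBound p ρ φ K) : lcbNorm p ρ φ ≤ K :=
  csInf_le ⟨0, fun _ h => h.1⟩ ⟨hK, h⟩

lemma IsCompleteBound.mulMap {N : Type*} [Fintype N] [DecidableEq N] {θ : V →ₗ[ℂ] Matrix N N ℂ}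
    (h : IsCompleteBound p ρ θ 1)
    {a : Matrix ι N ℂ} {b : Matrix N ι ℂ} {r : ℝ} (hr : 0 ≤ r)
    (ha : a * aᴴ = (r : ℂ) • (1 : Matrix ι ι ℂ)) (hb : bᴴ * b = (r : ℂ) • (1 : Matrix ι ι ℂ)) :
    IsCompleteBound p ρ (mulMap a θ b) r := fun k A => by
  have hb' := norm_kronecker_one_left k hr hb
  have ha' := norm_kronecker_one_left k hr (b := aᴴ) (by rwa [Matrix.conjTranspose_conjTranspose])
  have e : (1 : Matrix (Fin k) (Fin k) ℂ) ⊗ₖ aᴴ = ((1 : Matrix (Fin k) (Fin k) ℂ) ⊗ₖ a)ᴴ := by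
    rw [Matrix.conjTranspose_kronecker, Matrix.conjTranspose_one]
  rw [e, Matrix.l2_opNorm_conjTranspose] at ha'
  have hA := h k A
  rw [one_mul] at hA
  rw [amplify_mulMap]
  set x := (1 : Matrix (Fin k) (Fin k) ℂ) ⊗ₖ a
  set y := (1 : Matrix (Fin k) (Fin k) ℂ) ⊗ₖ b
  have hxy : ‖x‖ * ‖y‖ ≤ r := by nlinarith [sq_nonneg (‖x‖ - ‖y‖)]
  calc ‖x * amplify θ A * y‖ ≤ ‖x‖ * ‖amplify θ A‖ * ‖y‖ :=
        (Matrix.l2_opNorm_mul _ _).trans (mul_le_mul_of_nonneg_right (Matrix.l2_opNorm_mul _ _)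
          (norm_nonneg _))
    _ = (‖x‖ * ‖y‖) * ‖amplify θ A‖ := by ring
    _ ≤ r * p ρ k A := mul_le_mul hxy hA (norm_nonneg _) hr

end CompleteBounds

/-! ### Complete bounds of tensor products -/

namespace LocalOperatorSystem

variable {Γ Λ V W : Type*} [AddCommGroup V] [Module ℂ V] [StarAddMonoid V] [StarModule ℂ V]
  [AddCommGroup W] [Module ℂ W] [StarAddMonoid W] [StarModule ℂ W]
  {𝒮 : LocalOperatorSystem Γ V} {𝒯 : LocalOperatorSystem Λ W}
  {τ : LocalOperatorSystem (Γ × Λ) (V ⊗[ℂ] W)} {α : Γ} {β : Λ}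
  {ι κ : Type*} [Fintype ι] [Fintype κ] [DecidableEq ι] [DecidableEq κ]

lemma IsTensorStructure.isCompleteBound_one (hτ : IsTensorStructure 𝒮 𝒯 τ)
    {φ : V →ₗ[ℂ] Matrix ι ι ℂ} {ψ : W →ₗ[ℂ] Matrix κ κ ℂ}
    (hφ : IsCompleteBound 𝒮.seminorm α φ 1) (hψ : IsCompleteBound 𝒯.seminorm β ψ 1) :
    IsCompleteBound τ.seminorm (α, β) (tensorMap φ ψ) 1 := by
  -- Zero maps are separated off: when `-e` is positive there may be no unital completely positive
  -- map to compress.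
  rcases eq_or_ne φ 0 with rfl | hφ0
  · rw [tensorMap_zero_left]
    exact isCompleteBound_zero τ.seminorm_nonneg zero_le_one
  rcases eq_or_ne ψ 0 with rfl | hψ0
  · rw [tensorMap_zero_right]
    exact isCompleteBound_zero τ.seminorm_nonneg zero_le_one
  refine IsCompleteBound.of_forall_gt fun L hL => ?_
  obtain ⟨ε, hε, hεL⟩ : ∃ ε : ℝ, 0 < ε ∧ (1 + ε) * (1 + ε) = L :=
    ⟨√L - 1, by simpa [Real.lt_sqrt] using hL, by
      rw [add_sub_cancel, Real.mul_self_sqrt (by linarith)]⟩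
  obtain ⟨N, θ, a, b, hθ, hφe, ha, hb⟩ := exists_isLUCP_mulMap hφ0 hφ hε
  obtain ⟨M, η, c, d, hη, hψe, hc, hd⟩ := exists_isLUCP_mulMap hψ0 hψ hε
  have h1 := (hτ.isLUCP_tensorMap α β N M θ η hθ hη).isCompleteBound
  rw [hφe, hψe, tensorMap_mulMap]
  refine h1.mulMap (by linarith) ?_ ?_
  · rw [Matrix.conjTranspose_kronecker, ← Matrix.mul_kronecker_mul, ha, hc, Matrix.smul_kronecker,
      Matrix.kronecker_smul, Matrix.one_kronecker_one, smul_smul, ← Complex.ofReal_mul, hεL]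
  · rw [Matrix.conjTranspose_kronecker, ← Matrix.mul_kronecker_mul, hb, hd, Matrix.smul_kronecker,
      Matrix.kronecker_smul, Matrix.one_kronecker_one, smul_smul, ← Complex.ofReal_mul, hεL]

lemma IsTensorStructure.isCompleteBound_of_pos (hτ : IsTensorStructure 𝒮 𝒯 τ)
    {φ : V →ₗ[ℂ] Matrix ι ι ℂ} {ψ : W →ₗ[ℂ] Matrix κ κ ℂ} {K L : ℝ} (hK : 0 < K) (hL : 0 < L)
    (hφ : IsCompleteBound 𝒮.seminorm α φ K) (hψ : IsCompleteBound 𝒯.seminorm β ψ L) :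
    IsCompleteBound τ.seminorm (α, β) (tensorMap φ ψ) (K * L) := by
  have hKC : (K : ℂ) ≠ 0 := by exact_mod_cast hK.ne'
  have hLC : (L : ℂ) ≠ 0 := by exact_mod_cast hL.ne'
  have h1 : IsCompleteBound 𝒮.seminorm α ((K : ℂ)⁻¹ • φ) 1 := by
    simpa [abs_of_pos hK, hK.ne'] using hφ.smul (K : ℂ)⁻¹
  have h2 : IsCompleteBound 𝒯.seminorm β ((L : ℂ)⁻¹ • ψ) 1 := by
    simpa [abs_of_pos hL, hL.ne'] using hψ.smul (L : ℂ)⁻¹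
  have h3 := (hτ.isCompleteBound_one h1 h2).smul ((K : ℂ) * L)
  rwa [← tensorMap_smul_smul, smul_inv_smul₀ hKC, smul_inv_smul₀ hLC, norm_mul, mul_one,
    Complex.norm_real, Complex.norm_real, Real.norm_of_nonneg hK.le, Real.norm_of_nonneg hL.le]
    at h3

/-- Rescaling needs positive bounds, so a bound `0` is reached as a limit of `K + ε` and `L + ε`. -/
lemma IsTensorStructure.isCompleteBound (hτ : IsTensorStructure 𝒮 𝒯 τ)
    {φ : V →ₗ[ℂ] Matrix ι ι ℂ} {ψ : W →ₗ[ℂ] Matrix κ κ ℂ} {K L : ℝ} (hK : 0 ≤ K) (hL : 0 ≤ L)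
    (hφ : IsCompleteBound 𝒮.seminorm α φ K) (hψ : IsCompleteBound 𝒯.seminorm β ψ L) :
    IsCompleteBound τ.seminorm (α, β) (tensorMap φ ψ) (K * L) := fun k A => by
  have hc : Filter.Tendsto (fun ε : ℝ => (K + ε) * (L + ε) * τ.seminorm (α, β) k A)
      (nhdsWithin 0 (Set.Ioi 0)) (nhds ((K + 0) * (L + 0) * τ.seminorm (α, β) k A)) :=
    (Continuous.tendsto (by fun_prop) 0).mono_left nhdsWithin_le_nhds
  simp only [add_zero] at hc
  refine ge_of_tendsto hc (eventually_nhdsWithin_of_forall fun ε (hε : 0 < ε) => ?_)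
  exact hτ.isCompleteBound_of_pos (by positivity) (by positivity)
    (hφ.mono 𝒮.seminorm_nonneg (by linarith)) (hψ.mono 𝒯.seminorm_nonneg (by linarith)) k A

end LocalOperatorSystem

end

/-- A local operator system structure on a tensor product, with its induced matrix seminorms, is a
local operator space tensor product of the two factors. -/
theorem mainTheorem6 {Γ Λ S T : Type*}
    [AddCommGroup S] [Module ℂ S] [StarAddMonoid S] [StarModule ℂ S]
    [AddCommGroup T] [Module ℂ T] [StarAddMonoid T] [StarModule ℂ T]
    (𝒮 : LocalOperatorSystem Γ S) (𝒯 : LocalOperatorSystem Λ T)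
    (τ : LocalOperatorSystem (Γ × Λ) (S ⊗[ℂ] T))
    (hτ : LocalOperatorSystem.IsTensorStructure 𝒮 𝒯 τ) :
    IsLocalOperatorSpaceTensorProduct 𝒮.seminorm 𝒯.seminorm τ.seminorm where
  left := 𝒮.isLocalOperatorSpace
  right := 𝒯.isLocalOperatorSpace
  isLocalOperatorSpace := τ.isLocalOperatorSpace
  exists_index α β := by
    obtain ⟨γ, h⟩ := hτ.exists_index α β
    exact ⟨γ, fun _ _ A B => LocalOperatorSystem.seminorm_tensorMatrix_le hτ.unit_eq h A B⟩
  exists_pair γ := by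
    obtain ⟨α, β, h⟩ := hτ.exists_pair γ
    exact ⟨α, β, fun _ _ A B => LocalOperatorSystem.seminorm_tensorMatrix_le hτ.unit_eq h A B⟩
  lcb_tensorMap α β n m φ ψ hφ hψ := by
    have hK := lcbNorm_nonneg 𝒮.seminorm α φ
    have hL := lcbNorm_nonneg 𝒯.seminorm β ψ
    have h := hτ.isCompleteBound hK hL (hφ.isCompleteBound_lcbNorm 𝒮.seminorm_nonneg)
      (hψ.isCompleteBound_lcbNorm 𝒯.seminorm_nonneg)
    -- The product of the norms may be `0`, whereas `IsLCB` asks for a positive constant, hence the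
    -- added `1`.
    exact ⟨⟨_, by positivity, h.mono τ.seminorm_nonneg (lt_add_one _).le⟩,
      lcbNorm_le (mul_nonneg hK hL) h⟩
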